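/- For $(u_0,u_1)\in\mathbb{R}^2$ and a damping $\gamma\ge 0$ consider the focusing damped Duffing equation $$\ddot u+\gamma\dot u+u=u^3\quad (t\ge 0),\qquad (u(0),\dot u(0))=(u_0,u_1),$$ let "the solution" mean its maximal solution, defined on $[0,T^+)$ with $0<T^+\le\infty$, and say that it *blows up in finite time* if $T^+<\infty$. Put $E(u_0,u_1)=\frac{u_0^2}{2}-\frac{u_0^4}{4}+\frac{u_1^2}{2}$ and $$\mathcal N=\{E\ge\tfrac14\},\qquad \mathcal K^-=\{E<\tfrac14,\ |u_0|>1\},$$ $$\mathcal N_1=\{(u_0,u_1)\in\mathcal N: u_1>0,\ u_0\ge 1\},\quad \mathcal N_2=\{(u_0,u_1)\in\mathcal N: u_1>0,\ -1\le u_0<1\},\quad \mathcal N_3=\{(u_0,u_1)\in\mathcal N: u_1>0,\ u_0<-1\}.$$ The solution *enters* a set $S\subset\mathbb{R}^2$ if $(u(t),\dot u(t))\in S$ for some $t\in[0,T^+)$. It *converges to $q\in\mathbb{R}^2$ at an exponential rate* if $T^+=\infty$ and there are $C,c>0$ (which may depend on the solution) with $\|(u(t),\dot u(t))-q\|\le Ce^{-ct}$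 for all $t\ge 0$. **Theorem.** Let $(u_0,u_1)\in\mathcal N$ with $u_1>0$. For every $\gamma\ge0$ the Cauchy problem has a maximal solution, and the following hold. (i) If $(u_0,u_1)\in\mathcal N_1$, then for every $\gamma\ge 0$ the solution blows up in finite time. If in addition $\gamma>0$, then the solution enters $\mathcal K^-\cap\{u_0>1\}$. (ii) If $(u_0,u_1)\in\mathcal N_2$, then there exists $\gamma_0\ge 0$, depending only on $(u_0,u_1)$, such that for every $\gamma\ge 0$: - if $\gamma<\gamma_0$, the solution enters $\mathcal N_1$ and blows up in finite time; - if $\gamma=\gamma_0$, the solution converges to $(1,0)$ at an exponential rate; - if $\gamma>\gamma_0$, the solution converges to $(0,0)$ at an exponential rate. If in addition $E(u_0,u_1)=\frac14$, then $\gamma_0=0$. (iii) If $(u_0,u_1)\in\mathcal N_3$ and $E(u_0,u_1)>\frac14$, then there exist $\gamma_1>\gamma_0\ge 0$, depending only on $(u_0,u_1)$, such that for every $\gamma\ge 0$: - if $\gamma<\gamma_0$, the solution enters $\mathcal N_1$ and blows up in finite time; - if $\gamma=\gamma_0$, the solution converges to $(1,0)$ at an exponential rate; - if $\gamma_0<\gamma<\gamma_1$,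 the solution converges to $(0,0)$ at an exponential rate; - if $\gamma=\gamma_1$, the solution converges to $(-1,0)$ at an exponential rate; - if $\gamma>\gamma_1$, the solution enters $\mathcal K^-\cap\{u_0<-1\}$ and blows up in finite time. (iv) If $(u_0,u_1)\in\mathcal N_3$ and $E(u_0,u_1)=\frac14$, then for $\gamma=0$ the solution converges to $(-1,0)$ at an exponential rate, and for every $\gamma>0$ the solution enters $\mathcal K^-\cap\{u_0<-1\}$ and blows up in finite time. -/

import Mathlib

namespace Duffing

/-- The energy `E(u₀, u₁) = u₀² / 2 - u₀⁴ / 4 + u₁² / 2`. -/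
noncomputable def energy (p : ℝ × ℝ) : ℝ :=
  p.1 ^ 2 / 2 - p.1 ^ 4 / 4 + p.2 ^ 2 / 2

/-- The set `𝒦` of data of energy less than `1/4`. -/
def setK : Set (ℝ × ℝ) := {p | energy p < 1 / 4}

/-- The set `𝒩` of data of energy at least `1/4`. -/
def setN : Set (ℝ × ℝ) := {p | 1 / 4 ≤ energy p}

/-- The set `𝒦⁻`. -/
def setKMinus : Set (ℝ × ℝ) := {p | p ∈ setK ∧ 1 < |p.1|}

/-- The set `𝒩₁`. -/
def setN1 : Set (ℝ × ℝ) := {p | p ∈ setN ∧ 0 < p.2 ∧ 1 ≤ p.1}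

/-- The set `𝒩₂`. -/
def setN2 : Set (ℝ × ℝ) := {p | p ∈ setN ∧ 0 < p.2 ∧ -1 ≤ p.1 ∧ p.1 < 1}

/-- The set `𝒩₃`. -/
def setN3 : Set (ℝ × ℝ) := {p | p ∈ setN ∧ 0 < p.2 ∧ p.1 < -1}

/-- The time interval `[0, T)`, where `T` may be infinite. -/
def timeInterval (T : EReal) : Set ℝ := {t | 0 ≤ t ∧ (t : EReal) < T}

/-- `u` solves `u'' + γ u' + u = u³`, `(u(0), u'(0)) = (u₀, u₁)` on `[0, T)`, where `0 < T ≤ ∞`,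
and `v` is the derivative of `u` on `[0, T)`. The derivatives at `t = 0` are one-sided, those
at `t > 0` are two-sided. -/
structure IsSolutionOn (γ u₀ u₁ : ℝ) (T : EReal) (u v : ℝ → ℝ) : Prop where
  pos : 0 < T
  init : u 0 = u₀
  init_deriv : v 0 = u₁
  hasDeriv : ∀ t ∈ timeInterval T, HasDerivWithinAt u (v t) (Set.Ici 0) t
  hasDeriv_deriv : ∀ t ∈ timeInterval T,
    HasDerivWithinAt v (u t ^ 3 - u t - γ * v t) (Set.Ici 0) t

/-- `u`, with derivative `v`, is the maximal solution and `T` is its maximal time of existence: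
no solution of the same Cauchy problem lives on a longer interval. -/
structure IsMaximalSolution (γ u₀ u₁ : ℝ) (T : EReal) (u v : ℝ → ℝ) : Prop where
  isSolutionOn : IsSolutionOn γ u₀ u₁ T u v
  le_of_isSolutionOn : ∀ (S : EReal) (w z : ℝ → ℝ), IsSolutionOn γ u₀ u₁ S w z → S ≤ T

/-- Blow-up in finite time: the maximal time of existence `T` is finite. -/
def BlowsUp (T : EReal) : Prop := T < ⊤

/-- The trajectory `(u, v)`, defined on `[0, T)`, enters the set `S`. -/
def Enters (T : EReal) (u v : ℝ → ℝ) (S : Set (ℝ × ℝ)) : Prop :=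
  ∃ t ∈ timeInterval T, (u t, v t) ∈ S

/-- The trajectory `(u, v)` with maximal time of existence `T` is global and converges to `q`
at an exponential rate. -/
def ConvergesExponentially (T : EReal) (u v : ℝ → ℝ) (q : ℝ × ℝ) : Prop :=
  T = ⊤ ∧ ∃ C c : ℝ, 0 < C ∧ 0 < c ∧
    ∀ t : ℝ, 0 ≤ t → ‖(u t, v t) - q‖ ≤ C * Real.exp (-c * t)

end Duffing

namespace Duffing

open Set Filter Topology
open scoped NNReal

/-! Writing E = 1/4 − (1−u²)²/4 + v²/2, one has E' = −γv², and the saddles (±1, 0) lie at the level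
1/4. Below that level a trajectory is confined to |u| < 1, u > 1 or u < −1. In the first region a
Lyapunov function gives exponential decay to 0 when γ > 0; in the other two the velocity cannot keep
its sign, which excludes global solutions. Global solutions are also excluded once u ≥ 1 and v > 0,
by a barrier v > κ(u²−1) (`IsSolutionOn.false_of_one_le`).

At levels at least 1/4 with v > 0 one has v ≥ |1−u²|/2. Hence a trajectory approaching a saddle
position ℓ = ±1 from the left that neither crosses ℓ nor falls below the level 1/4 moves
monotonically and converges exponentially to (ℓ, 0). So each saddle offers three alternatives:
crossing, falling below the level, convergence. The first two are open conditions on γ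
(`isOpen_reaches`).

It remains to isolate the third. As a function of position the velocity satisfies dv/du = (u³−u)/v −
γ, so at equal positions the smaller damping is strictly faster, and the gap grows where u³ − u ≤ 0,
in particular just to the left of either saddle (`IsSolutionOn.comparison`). Therefore, if a damping
γ' leads to crossing or convergence, every smaller damping leads to crossing
(`IsMaximalSolution.exists_lt_of_sweeps`). Such γ' are bounded, by the dissipation estimate
`IsSolutionOn.energy_add_le` or, for the second threshold in 𝒩₃, by γ₁; and `exists_threshold`
produces a single critical damping.

In 𝒩₃ the two thresholds differ: slightly below γ₁ the trajectory crosses −1 with energy barely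
above 1/4, and travelling from −1 to 0 would cost more than the excess
(`exists_reaches_setKPlus_lt`). -/

/-- The vector field of the Duffing equation in the phase plane. -/
def field (γ : ℝ) (p : ℝ × ℝ) : ℝ × ℝ := (p.2, p.1 ^ 3 - p.1 - γ * p.2)

/-! ### Globally Lipschitz truncation of the vector field -/

/-- Truncation of a real number to `[-R, R]`. -/
noncomputable def clip (R x : ℝ) : ℝ := max (-R) (min R x)

/-- The Duffing vector field, truncated outside of the ball of radius `R`. -/
noncomputable def cutField (R γ : ℝ) (p : ℝ × ℝ) : ℝ × ℝ := field γ (clip R p.1, clip R p.2)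

lemma clip_of_abs_le {R x : ℝ} (h : |x| ≤ R) : clip R x = x := by
  rw [abs_le] at h
  simp [clip, h.1, h.2]

lemma abs_clip_le {R : ℝ} (hR : 0 ≤ R) (x : ℝ) : |clip R x| ≤ R := by
  rw [abs_le]
  exact ⟨le_max_left _ _, max_le (by linarith) (min_le_left _ _)⟩

lemma cutField_of_norm_le {R γ : ℝ} {p : ℝ × ℝ} (h : ‖p‖ ≤ R) : cutField R γ p = field γ p := by
  have h1 : |p.1| ≤ R := (norm_fst_le p).trans h
  have h2 : |p.2| ≤ R := (norm_snd_le p).trans h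
  simp [cutField, clip_of_abs_le h1, clip_of_abs_le h2]

lemma contDiff_field (γ : ℝ) : ContDiff ℝ 1 (field γ) := by
  unfold field
  fun_prop

lemma clip_pair_mem {R : ℝ} (hR : 0 ≤ R) (p : ℝ × ℝ) :
    (clip R p.1, clip R p.2) ∈ Metric.closedBall (0 : ℝ × ℝ) R := by
  rw [mem_closedBall_zero_iff]
  exact max_le (abs_clip_le hR _) (abs_clip_le hR _)

lemma lipschitzWith_clip (R : ℝ) : LipschitzWith 1 (clip R) :=
  (LipschitzWith.id.const_min R).const_max (-R)

lemma exists_lipschitzWith_cutField {R : ℝ} (hR : 0 ≤ R) (γ : ℝ) :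
    ∃ K : ℝ≥0, LipschitzWith K (cutField R γ) := by
  obtain ⟨K, hK⟩ := (contDiff_field γ).contDiffOn.exists_lipschitzOnWith (n := 1) one_ne_zero
    (convex_closedBall (0 : ℝ × ℝ) R) (isCompact_closedBall (0 : ℝ × ℝ) R)
  refine ⟨K, LipschitzWith.of_dist_le_mul fun p q => ?_⟩
  refine (hK.dist_le_mul _ (clip_pair_mem hR p) _ (clip_pair_mem hR q)).trans ?_
  gcongr
  have h1 := (lipschitzWith_clip R).dist_le_mul p.1 q.1
  have h2 := (lipschitzWith_clip R).dist_le_mul p.2 q.2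
  simp only [NNReal.coe_one, one_mul] at h1 h2
  exact max_le_max h1 h2

lemma exists_norm_cutField_le {R : ℝ} (hR : 0 ≤ R) (γ : ℝ) :
    ∃ L : ℝ≥0, ∀ p, ‖cutField R γ p‖ ≤ L := by
  obtain ⟨C, hC⟩ := (isCompact_closedBall (0 : ℝ × ℝ) R).exists_bound_of_continuousOn
    (contDiff_field γ).continuous.continuousOn
  exact ⟨C.toNNReal, fun p => (hC _ (clip_pair_mem hR p)).trans (Real.le_coe_toNNReal C)⟩

/-- Truncation bounds the velocity, so a change of damping perturbs the field uniformly on the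
plane; this is the defect fed into Gronwall's inequality. -/
lemma dist_cutField_le {R : ℝ} (hR : 0 ≤ R) (γ γ' : ℝ) (p : ℝ × ℝ) :
    dist (cutField R γ p) (cutField R γ' p) ≤ |γ - γ'| * R := by
  have h : cutField R γ p - cutField R γ' p = (0, (γ' - γ) * clip R p.2) := by
    ext <;> simp [cutField, field]
    ring
  rw [dist_eq_norm, h, Prod.norm_mk]
  simp only [norm_zero, norm_mul, Real.norm_eq_abs]
  rw [abs_sub_comm γ' γ]
  have := abs_clip_le hR p.2
  exact max_le (by positivity) (by gcongr)

lemma exists_cutField_solution {R : ℝ} (hR : 0 ≤ R) (γ : ℝ) (p : ℝ × ℝ) {b : ℝ} (hb : 0 < b) :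
    ∃ x : ℝ → ℝ × ℝ, x 0 = p ∧
      ∀ t ∈ Ico 0 b, HasDerivWithinAt x (cutField R γ (x t)) (Ici 0) t := by
  obtain ⟨K, hK⟩ := exists_lipschitzWith_cutField hR γ
  obtain ⟨L, hL⟩ := exists_norm_cutField_le hR γ
  -- The radius L·b is the farthest that a curve of speed at most L can travel in time b, so no
  -- smallness of b is needed.
  have hPL : IsPicardLindelof (fun _ => cutField R γ) (tmin := 0) (tmax := b)
      ⟨0, le_rfl, hb.le⟩ p (L * b.toNNReal) 0 L K :=
    { lipschitzOnWith := fun t _ => hK.lipschitzOnWith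
      continuousOn := fun x _ => continuousOn_const
      norm_le := fun t _ x _ => hL x
      mul_max_le := by simp [hb.le] }
  obtain ⟨x, hx0, hx⟩ := hPL.exists_eq_forall_mem_Icc_hasDerivWithinAt₀
  refine ⟨x, hx0, fun t ht => ?_⟩
  refine (hx t ⟨ht.1, ht.2.le⟩).mono_of_mem_nhdsWithin ?_
  rw [mem_nhdsWithin]
  exact ⟨Iio b, isOpen_Iio, ht.2, fun s hs => ⟨hs.2, le_of_lt hs.1⟩⟩

/-! ### Uniqueness and maximal solutions -/

section Basic

variable {γ u₀ u₁ : ℝ} {T : EReal} {u v : ℝ → ℝ}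

lemma mem_timeInterval_of_le {s t : ℝ} (ht : t ∈ timeInterval T) (hs : 0 ≤ s) (hst : s ≤ t) :
    s ∈ timeInterval T :=
  ⟨hs, lt_of_le_of_lt (by exact_mod_cast hst) ht.2⟩

lemma exists_gt_mem_timeInterval {t : ℝ} (ht : t ∈ timeInterval T) :
    ∃ b, t < b ∧ b ∈ timeInterval T := by
  obtain ⟨b, hb1, hb2⟩ := EReal.lt_iff_exists_real_btwn.mp ht.2
  have hb1 : t < b := by exact_mod_cast hb1
  exact ⟨b, hb1, ht.1.trans hb1.le, hb2⟩

lemma mem_timeInterval_coe {b t : ℝ} : t ∈ timeInterval (b : EReal) ↔ t ∈ Ico 0 b := by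
  simp [timeInterval]

lemma mem_timeInterval_top {t : ℝ} : t ∈ timeInterval ⊤ ↔ 0 ≤ t := by
  simp [timeInterval, EReal.coe_lt_top]

namespace IsSolutionOn

lemma zero_mem (h : IsSolutionOn γ u₀ u₁ T u v) : (0 : ℝ) ∈ timeInterval T :=
  ⟨le_rfl, by exact_mod_cast h.pos⟩

lemma hasDerivWithinAt_pair (h : IsSolutionOn γ u₀ u₁ T u v) {t : ℝ} (ht : t ∈ timeInterval T) :
    HasDerivWithinAt (fun t => (u t, v t)) (field γ (u t, v t)) (Ici 0) t :=
  (h.hasDeriv t ht).prodMk (h.hasDeriv_deriv t ht)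

lemma continuousOn_pair (h : IsSolutionOn γ u₀ u₁ T u v) {a b : ℝ} (ha : 0 ≤ a)
    (hb : b ∈ timeInterval T) : ContinuousOn (fun t => (u t, v t)) (Icc a b) := fun _ ht =>
  (h.hasDerivWithinAt_pair (mem_timeInterval_of_le hb (ha.trans ht.1) ht.2)).continuousWithinAt.mono
    (fun _ hs => ha.trans hs.1)

lemma exists_bound (h : IsSolutionOn γ u₀ u₁ T u v) {b : ℝ} (hb : b ∈ timeInterval T) :
    ∃ R, 0 ≤ R ∧ ∀ t ∈ Icc 0 b, ‖(u t, v t)‖ ≤ R := by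
  obtain ⟨C, hC⟩ := isCompact_Icc.exists_bound_of_continuousOn (h.continuousOn_pair le_rfl hb)
  exact ⟨C, (norm_nonneg _).trans (hC 0 ⟨le_rfl, hb.1⟩), hC⟩

/-- Inside the ball of radius R the two fields agree, so a bounded piece of trajectory solves the
globally Lipschitz problem, where uniqueness is available. -/
lemma eqOn_of_cutField {x : ℝ → ℝ × ℝ} {R b : ℝ} (h : IsSolutionOn γ u₀ u₁ T u v)
    (hb : b ∈ timeInterval T) (hR : ∀ t ∈ Icc 0 b, ‖(u t, v t)‖ ≤ R) (hx0 : x 0 = (u₀, u₁))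
    (hx : ∀ t ∈ Icc 0 b, HasDerivWithinAt x (cutField R γ (x t)) (Ici 0) t) :
    EqOn (fun t => (u t, v t)) x (Icc 0 b) := by
  have hR0 : 0 ≤ R := (norm_nonneg _).trans (hR 0 ⟨le_rfl, hb.1⟩)
  obtain ⟨K, hK⟩ := exists_lipschitzWith_cutField hR0 γ
  refine ODE_solution_unique (v := fun _ => cutField R γ) (fun _ => hK)
    (h.continuousOn_pair le_rfl hb) (fun t ht => ?_)
    (fun t ht => (hx t ht).continuousWithinAt.mono fun s hs => hs.1)
    (fun t ht => (hx t ⟨ht.1, ht.2.le⟩).mono (Ici_subset_Ici.2 ht.1)) ?_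
  · rw [cutField_of_norm_le (hR t ⟨ht.1, ht.2.le⟩)]
    exact (h.hasDerivWithinAt_pair (mem_timeInterval_of_le hb ht.1 ht.2.le)).mono
      (Ici_subset_Ici.2 ht.1)
  · simp [hx0, h.init, h.init_deriv]

lemma eq_of_mem {S : EReal} {w z : ℝ → ℝ} (h : IsSolutionOn γ u₀ u₁ T u v)
    (h' : IsSolutionOn γ u₀ u₁ S w z) {t : ℝ} (ht : t ∈ timeInterval T)
    (ht' : t ∈ timeInterval S) : u t = w t ∧ v t = z t := by
  obtain ⟨R, -, hR⟩ := h.exists_bound ht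
  obtain ⟨R', -, hR'⟩ := h'.exists_bound ht'
  have key := h.eqOn_of_cutField (x := fun t => (w t, z t)) (R := max R R') ht
    (fun s hs => (hR s hs).trans (le_max_left _ _)) (by simp [h'.init, h'.init_deriv])
    (fun s hs => by
      rw [cutField_of_norm_le ((hR' s hs).trans (le_max_right _ _))]
      exact h'.hasDerivWithinAt_pair (mem_timeInterval_of_le ht' hs.1 hs.2))
  simpa using key ⟨ht.1, le_rfl⟩

end IsSolutionOn

lemma isSolutionOn_of_cutField {x : ℝ → ℝ × ℝ} {R b : ℝ} (hb : 0 < b) (hx0 : x 0 = (u₀, u₁))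
    (hx : ∀ t ∈ Ico 0 b, HasDerivWithinAt x (cutField R γ (x t)) (Ici 0) t)
    (hR : ∀ t ∈ Ico 0 b, ‖x t‖ ≤ R) :
    IsSolutionOn γ u₀ u₁ b (fun t => (x t).1) (fun t => (x t).2) := by
  have hx' : ∀ t ∈ Ico 0 b, HasDerivWithinAt x (field γ (x t)) (Ici 0) t := fun t ht => by
    rw [← cutField_of_norm_le (hR t ht)]
    exact hx t ht
  refine ⟨by exact_mod_cast hb, by simp [hx0], by simp [hx0], fun t ht => ?_, fun t ht => ?_⟩
  · exact hasFDerivAt_fst.comp_hasDerivWithinAt t (hx' t (mem_timeInterval_coe.1 ht))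
  · exact hasFDerivAt_snd.comp_hasDerivWithinAt t (hx' t (mem_timeInterval_coe.1 ht))

lemma exists_norm_le_right {x : ℝ → ℝ × ℝ} {a R : ℝ} (ha : 0 ≤ a)
    (hx : ContinuousWithinAt x (Ici 0) a) (hR : ‖x a‖ < R) :
    ∃ ε > 0, ∀ t ∈ Ico a (a + ε), ‖x t‖ ≤ R := by
  have h1 : ∀ᶠ t in 𝓝[≥] a, ‖x t‖ < R :=
    (hx.mono (Ici_subset_Ici.2 ha)).norm.eventually_lt continuousWithinAt_const hR
  obtain ⟨c, hc, hc'⟩ := mem_nhdsGE_iff_exists_Ico_subset.1 h1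
  exact ⟨c - a, sub_pos.2 hc, fun t ht => le_of_lt (hc' ⟨ht.1, by linarith [ht.2]⟩)⟩

lemma exists_isSolutionOn (γ u₀ u₁ : ℝ) : ∃ (b : ℝ) (u v : ℝ → ℝ), IsSolutionOn γ u₀ u₁ b u v := by
  have hR : 0 ≤ ‖(u₀, u₁)‖ + 1 := by positivity
  obtain ⟨x, hx0, hx⟩ := exists_cutField_solution hR γ (u₀, u₁) one_pos
  obtain ⟨ε, hε, hxε⟩ := exists_norm_le_right (R := ‖(u₀, u₁)‖ + 1) le_rfl
    (hx 0 ⟨le_rfl, one_pos⟩).continuousWithinAt (by rw [hx0]; linarith)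
  exact ⟨min 1 ε, _, _, isSolutionOn_of_cutField (lt_min one_pos hε) hx0
    (fun t ht => hx t ⟨ht.1, ht.2.trans_le (min_le_left _ _)⟩)
    (fun t ht => hxε t ⟨ht.1, by linarith [ht.2.trans_le (min_le_right 1 ε)]⟩)⟩

/-- The maximal solution is the union of all solutions and T is the supremum of their lifetimes;
uniqueness makes the pointwise choice of values consistent. -/
theorem exists_isMaximalSolution (γ u₀ u₁ : ℝ) :
    ∃ (T : EReal) (u v : ℝ → ℝ), IsMaximalSolution γ u₀ u₁ T u v := by
  let A : Set EReal := {S | ∃ w z, IsSolutionOn γ u₀ u₁ S w z}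
  have key : ∀ t : ℝ, ∃ p : ℝ × ℝ, t ∈ timeInterval (sSup A) →
      ∃ S w z, IsSolutionOn γ u₀ u₁ S w z ∧ t ∈ timeInterval S ∧ p = (w t, z t) := by
    intro t
    by_cases ht : t ∈ timeInterval (sSup A)
    · obtain ⟨S, ⟨w, z, hS⟩, htS⟩ := lt_sSup_iff.1 ht.2
      exact ⟨(w t, z t), fun _ => ⟨S, w, z, hS, ⟨ht.1, htS⟩, rfl⟩⟩
    · exact ⟨0, fun h => absurd h ht⟩
  choose p hp using key
  have heq : ∀ S w z, IsSolutionOn γ u₀ u₁ S w z → ∀ t ∈ timeInterval S, p t = (w t, z t) := by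
    intro S w z hS t ht
    obtain ⟨S', w', z', hS', ht', hpt⟩ := hp t ⟨ht.1, ht.2.trans_le (le_sSup ⟨w, z, hS⟩)⟩
    obtain ⟨h1, h2⟩ := hS.eq_of_mem hS' ht ht'
    rw [hpt, h1, h2]
  obtain ⟨b, u, v, hb⟩ := exists_isSolutionOn γ u₀ u₁
  have hp0 := heq _ _ _ hb 0 hb.zero_mem
  have hder : ∀ t ∈ timeInterval (sSup A), HasDerivWithinAt p (field γ (p t)) (Ici 0) t := by
    intro t ht
    obtain ⟨S, w, z, hS, htS, hpt⟩ := hp t ht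
    rw [hpt]
    refine (hS.hasDerivWithinAt_pair htS).congr_of_eventuallyEq ?_ hpt
    obtain ⟨c, hc, hcS⟩ := exists_gt_mem_timeInterval htS
    have : Iio c ∈ 𝓝[Ici 0] t := mem_nhdsWithin_of_mem_nhds (Iio_mem_nhds hc)
    filter_upwards [this, self_mem_nhdsWithin] with s hs hs0
    exact heq _ _ _ hS s (mem_timeInterval_of_le hcS hs0 (le_of_lt hs))
  refine ⟨sSup A, fun t => (p t).1, fun t => (p t).2, ⟨?_, ?_, ?_, fun t ht => ?_, fun t ht => ?_⟩,
    fun S w z h => le_sSup ⟨w, z, h⟩⟩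
  · exact hb.pos.trans_le (le_sSup ⟨u, v, hb⟩)
  · simp [hp0, hb.init]
  · simp [hp0, hb.init_deriv]
  · exact hasFDerivAt_fst.comp_hasDerivWithinAt t (hder t ht)
  · exact hasFDerivAt_snd.comp_hasDerivWithinAt t (hder t ht)

namespace IsMaximalSolution

lemma unique {S : EReal} {w z : ℝ → ℝ} (h : IsMaximalSolution γ u₀ u₁ T u v)
    (h' : IsMaximalSolution γ u₀ u₁ S w z) :
    T = S ∧ ∀ t ∈ timeInterval T, u t = w t ∧ v t = z t := by
  have hTS : T = S := le_antisymm (h'.le_of_isSolutionOn _ _ _ h.isSolutionOn)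
    (h.le_of_isSolutionOn _ _ _ h'.isSolutionOn)
  subst hTS
  exact ⟨rfl, fun t ht => h.isSolutionOn.eq_of_mem h'.isSolutionOn ht ht⟩

/-- A bounded maximal solution is global. -/
theorem eq_top_of_bounded (h : IsMaximalSolution γ u₀ u₁ T u v) {R : ℝ}
    (hR : ∀ t ∈ timeInterval T, |u t| ≤ R ∧ |v t| ≤ R) : T = ⊤ := by
  by_contra hT
  have hsol := h.isSolutionOn
  obtain ⟨b, rfl⟩ : ∃ b : ℝ, (b : EReal) = T :=
    ⟨T.toReal, EReal.coe_toReal hT (ne_bot_of_gt hsol.pos)⟩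
  have hb : 0 < b := by exact_mod_cast hsol.pos
  have hR' : ∀ t ∈ Ico 0 b, ‖(u t, v t)‖ ≤ R := fun t ht => by
    obtain ⟨h1, h2⟩ := hR t (mem_timeInterval_coe.2 ht)
    exact max_le h1 h2
  have hR0 : 0 ≤ R := (norm_nonneg _).trans (hR' 0 ⟨le_rfl, hb⟩)
  -- The truncation radius exceeds the bound by 1, so the truncated solution still solves the
  -- original equation for a short time past b.
  obtain ⟨x, hx0, hx⟩ := exists_cutField_solution (R := R + 1) (by linarith) γ (u₀, u₁)
    (b := b + 1) (by linarith)
  have heq : ∀ t ∈ Ico 0 b, (u t, v t) = x t := fun t ht =>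
    hsol.eqOn_of_cutField (R := R + 1) (mem_timeInterval_coe.2 ht)
      (fun s hs => (hR' s ⟨hs.1, hs.2.trans_lt ht.2⟩).trans (by linarith)) hx0
      (fun s hs => hx s ⟨hs.1, by linarith [hs.2, ht.2]⟩) ⟨ht.1, le_rfl⟩
  have hcont : ContinuousWithinAt x (Ici 0) b :=
    (hx b ⟨hb.le, by linarith⟩).continuousWithinAt
  have hxb : ‖x b‖ ≤ R := by
    have h1 : Tendsto (fun t => ‖x t‖) (𝓝[<] b) (𝓝 ‖x b‖) :=
      ((hcont.continuousAt (Ici_mem_nhds hb)).norm.tendsto).mono_left nhdsWithin_le_nhds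
    refine le_of_tendsto h1 ?_
    filter_upwards [Ioo_mem_nhdsLT hb] with t ht
    rw [← heq t ⟨ht.1.le, ht.2⟩]
    exact hR' t ⟨ht.1.le, ht.2⟩
  obtain ⟨ε, hε, hxε⟩ := exists_norm_le_right (R := R + 1) hb.le hcont (by linarith)
  have hnew := isSolutionOn_of_cutField (γ := γ) (b := b + min ε 1) (x := x) (R := R + 1)
    (by positivity) hx0 (fun t ht => hx t ⟨ht.1, by linarith [ht.2, min_le_right ε 1]⟩)
    (fun t ht => by
      rcases lt_or_ge t b with htb | htb
      · rw [← heq t ⟨ht.1, htb⟩]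
        exact (hR' t ⟨ht.1, htb⟩).trans (by linarith)
      · exact hxε t ⟨htb, by linarith [ht.2, min_le_left ε 1]⟩)
  have hle := h.le_of_isSolutionOn _ _ _ hnew
  have hle : b + min ε 1 ≤ b := by exact_mod_cast hle
  have : 0 < min ε 1 := lt_min hε one_pos
  linarith

/-! ### Stability of finite-time behaviour under change of damping -/

/-- Continuous dependence of the solution on the damping. -/
theorem exists_dist_lt (h : IsMaximalSolution γ u₀ u₁ T u v) {t : ℝ} (ht : t ∈ timeInterval T)
    {ε : ℝ} (hε : 0 < ε) :
    ∃ δ > 0, ∀ γ', |γ' - γ| < δ → ∀ T' u' v', IsMaximalSolution γ' u₀ u₁ T' u' v' →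
      t ∈ timeInterval T' ∧ dist (u' t, v' t) (u t, v t) < ε := by
  obtain ⟨b, htb, hb⟩ := exists_gt_mem_timeInterval ht
  have hb0 : 0 < b := ht.1.trans_lt htb
  have hsol := h.isSolutionOn
  obtain ⟨R, hR0, hR⟩ := hsol.exists_bound hb
  have hR1 : 0 ≤ R + 1 := by linarith
  obtain ⟨K, hK⟩ := exists_lipschitzWith_cutField hR1 γ
  have hcont : Tendsto (fun η : ℝ => gronwallBound 0 K (η * (R + 1)) b) (𝓝 0) (𝓝 0) := by
    have h1 : Continuous fun η : ℝ => gronwallBound 0 K (η * (R + 1)) b :=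
      (gronwallBound_continuous_ε 0 K b).comp (by fun_prop)
    simpa [gronwallBound_ε0_δ0] using h1.tendsto 0
  -- The bound 1 keeps the perturbed curve in the ball of radius R + 1, where the truncation is
  -- inactive; this also shows that the perturbed solution lives beyond t.
  have hev := hcont.eventually_lt_const (lt_min hε one_pos)
  obtain ⟨δ, hδ, hδ'⟩ := Metric.eventually_nhds_iff.1 hev
  refine ⟨δ, hδ, fun γ' hγ' T' u' v' h' => ?_⟩
  obtain ⟨x, hx0, hx⟩ := exists_cutField_solution hR1 γ' (u₀, u₁) (b := b + 1) (by linarith)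
  have hη : gronwallBound 0 K (|γ' - γ| * (R + 1)) b < min ε 1 :=
    hδ' (by simpa [Real.dist_eq] using hγ')
  have hdist : ∀ s ∈ Icc 0 b, dist (x s) (u s, v s) < min ε 1 := by
    intro s hs
    have := dist_le_of_approx_trajectories_ODE (v := fun _ => cutField (R + 1) γ) (K := K)
      (f := x) (g := fun t => (u t, v t)) (a := 0) (b := b) (δ := 0) (εf := |γ' - γ| * (R + 1))
      (εg := 0) (f' := fun s => cutField (R + 1) γ' (x s)) (g' := fun s => field γ (u s, v s))
      (fun _ => hK)
      (fun s hs => (hx s ⟨hs.1, by linarith [hs.2]⟩).continuousWithinAt.mono fun r hr => hr.1)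
      (fun s hs => (hx s ⟨hs.1, by linarith [hs.2]⟩).mono (Ici_subset_Ici.2 hs.1))
      (fun s hs => dist_cutField_le hR1 _ _ _)
      (hsol.continuousOn_pair le_rfl hb)
      (fun s hs => (hsol.hasDerivWithinAt_pair (mem_timeInterval_of_le hb hs.1 hs.2.le)).mono
        (Ici_subset_Ici.2 hs.1))
      (fun s hs => by
        rw [cutField_of_norm_le ((hR s ⟨hs.1, hs.2.le⟩).trans (by linarith)), dist_self])
      (by simp [hx0, hsol.init, hsol.init_deriv]) s hs
    refine lt_of_le_of_lt (this.trans ?_) hη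
    rw [sub_zero, add_zero]
    exact gronwallBound_mono le_rfl (by positivity) K.2 hs.2
  have hnorm : ∀ s ∈ Ico 0 b, ‖x s‖ ≤ R + 1 := by
    intro s hs
    have hs' : s ∈ Icc 0 b := ⟨hs.1, hs.2.le⟩
    have h1 := (hdist s hs').trans_le (min_le_right _ _)
    have h2 := hR s hs'
    have h3 := norm_le_norm_add_norm_sub' (x s) (u s, v s)
    rw [dist_eq_norm] at h1
    linarith
  have hnew := isSolutionOn_of_cutField hb0 hx0
    (fun s hs => hx s ⟨hs.1, by linarith [hs.2]⟩) hnorm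
  have hbT' := h'.le_of_isSolutionOn _ _ _ hnew
  have ht' : t ∈ timeInterval T' := ⟨ht.1, lt_of_lt_of_le (by exact_mod_cast htb) hbT'⟩
  refine ⟨ht', ?_⟩
  obtain ⟨h1, h2⟩ := h'.isSolutionOn.eq_of_mem hnew ht' (mem_timeInterval_coe.2 ⟨ht.1, htb⟩)
  rw [h1, h2]
  exact (hdist t ⟨ht.1, htb.le⟩).trans_le (min_le_left _ _)

end IsMaximalSolution

/-- The maximal solution with damping `γ` enters the set `S`. -/
def Reaches (u₀ u₁ : ℝ) (S : Set (ℝ × ℝ)) (γ : ℝ) : Prop :=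
  ∃ (T : EReal) (u v : ℝ → ℝ), IsMaximalSolution γ u₀ u₁ T u v ∧ Enters T u v S

lemma IsMaximalSolution.reaches_iff {S : Set (ℝ × ℝ)} (h : IsMaximalSolution γ u₀ u₁ T u v) :
    Reaches u₀ u₁ S γ ↔ Enters T u v S := by
  refine ⟨?_, fun hS => ⟨T, u, v, h, hS⟩⟩
  rintro ⟨T', u', v', h', t, ht, htS⟩
  obtain ⟨rfl, heq⟩ := h'.unique h
  refine ⟨t, ht, ?_⟩
  rw [← (heq t ht).1, ← (heq t ht).2]
  exact htS

/-- Entering an open set is witnessed at one time, and the state at that time depends continuously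
on γ. -/
theorem isOpen_reaches {S : Set (ℝ × ℝ)} (hS : IsOpen S) (u₀ u₁ : ℝ) :
    IsOpen {γ | Reaches u₀ u₁ S γ} := by
  rw [Metric.isOpen_iff]
  rintro γ ⟨T, u, v, h, t, ht, htS⟩
  obtain ⟨ε, hε, hεS⟩ := Metric.isOpen_iff.1 hS _ htS
  obtain ⟨δ, hδ, hδ'⟩ := h.exists_dist_lt ht hε
  refine ⟨δ, hδ, fun γ' hγ' => ?_⟩
  obtain ⟨T', u', v', h'⟩ := exists_isMaximalSolution γ' u₀ u₁
  obtain ⟨h1, h2⟩ := hδ' γ' hγ' T' u' v' h'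
  exact ⟨T', u', v', h', t, h1, hεS h2⟩

end Basic

/-! ### One-sided calculus and first-zero arguments -/

section Calculus

lemma monotoneOn_Icc_of_deriv_nonneg {f f' : ℝ → ℝ} {a b : ℝ} (ha : 0 ≤ a)
    (hf : ∀ t ∈ Icc a b, HasDerivWithinAt f (f' t) (Ici 0) t) (h : ∀ t ∈ Ioo a b, 0 ≤ f' t) :
    MonotoneOn f (Icc a b) := by
  refine monotoneOn_of_hasDerivWithinAt_nonneg (f' := f') (convex_Icc a b)
    (fun t ht => (hf t ht).continuousWithinAt.mono fun s hs => ha.trans hs.1)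
    (fun t ht => ?_) (fun t ht => h t (by simpa using ht))
  exact (hf t (interior_subset ht)).mono fun s hs => ha.trans (interior_subset hs).1

lemma add_mul_le_of_le_deriv {f f' : ℝ → ℝ} {a b m : ℝ} (ha : 0 ≤ a) (hab : a ≤ b)
    (hf : ∀ t ∈ Icc a b, HasDerivWithinAt f (f' t) (Ici 0) t) (h : ∀ t ∈ Ioo a b, m ≤ f' t) :
    f a + m * (b - a) ≤ f b := by
  have hd : ∀ t ∈ Icc a b, HasDerivWithinAt (fun s => f s - m * s) (f' t - m) (Ici 0) t :=
    fun t ht => by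
      simpa using (hf t ht).fun_sub ((hasDerivWithinAt_id t (Ici 0)).const_mul m)
  have := monotoneOn_Icc_of_deriv_nonneg ha hd (fun t ht => sub_nonneg.2 (h t ht))
    ⟨le_rfl, hab⟩ ⟨hab, le_rfl⟩ hab
  simp only at this
  linarith

lemma le_of_deriv_nonpos {f f' : ℝ → ℝ} {a b : ℝ} (ha : 0 ≤ a) (hab : a ≤ b)
    (hf : ∀ t ∈ Icc a b, HasDerivWithinAt f (f' t) (Ici 0) t) (h : ∀ t ∈ Ioo a b, f' t ≤ 0) :
    f b ≤ f a := by
  have := add_mul_le_of_le_deriv (f := fun t => -f t) (f' := fun t => -f' t) (m := 0) ha hab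
    (fun t ht => (hf t ht).fun_neg) (fun t ht => by linarith [h t ht])
  linarith

lemma lt_of_deriv_pos {f f' : ℝ → ℝ} {a b : ℝ} (ha : 0 ≤ a) (hab : a < b)
    (hf : ∀ t ∈ Icc a b, HasDerivWithinAt f (f' t) (Ici 0) t) (h : ∀ t ∈ Ioo a b, 0 < f' t) :
    f a < f b := by
  refine strictMonoOn_of_deriv_pos (convex_Icc a b)
    (fun t ht => (hf t ht).continuousWithinAt.mono fun s hs => ha.trans hs.1)
    (fun t ht => ?_) ⟨le_rfl, hab.le⟩ ⟨hab.le, le_rfl⟩ hab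
  rw [interior_Icc] at ht
  rw [((hf t ⟨ht.1.le, ht.2.le⟩).hasDerivAt (Ici_mem_nhds (ha.trans_lt ht.1))).deriv]
  exact h t ht

/-- If `f` satisfies `f' ≤ -c f` then it decays exponentially. -/
lemma le_mul_exp_of_deriv_le {f f' : ℝ → ℝ} {a b c : ℝ} (ha : 0 ≤ a) (hab : a ≤ b)
    (hf : ∀ t ∈ Icc a b, HasDerivWithinAt f (f' t) (Ici 0) t)
    (h : ∀ t ∈ Ioo a b, f' t ≤ -c * f t) : f b ≤ f a * Real.exp (c * a) * Real.exp (-c * b) := by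
  have hd : ∀ t ∈ Icc a b, HasDerivWithinAt (fun s => f s * Real.exp (c * s))
      (f' t * Real.exp (c * t) + f t * (Real.exp (c * t) * c)) (Ici 0) t := fun t ht => by
    have he : HasDerivAt (fun s => Real.exp (c * s)) (Real.exp (c * t) * c) t := by
      simpa using ((hasDerivAt_id t).const_mul c).exp
    exact (hf t ht).mul he.hasDerivWithinAt
  have := le_of_deriv_nonpos ha hab hd (fun t ht => by
    have h1 := h t ht
    have h2 := Real.exp_pos (c * t)
    nlinarith)
  calc f b = f b * Real.exp (c * b) * Real.exp (-c * b) := by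
        rw [mul_assoc, ← Real.exp_add]; simp
    _ ≤ _ := by gcongr

/-- A continuous function which is positive at the left end point and cannot have a first zero is
positive. -/
lemma pos_of_no_first_zero {g : ℝ → ℝ} {a b : ℝ} (hg : ContinuousOn g (Icc a b)) (ha : 0 < g a)
    (hne : ∀ t ∈ Ioc a b, (∀ s ∈ Ico a t, 0 < g s) → g t ≠ 0) : ∀ t ∈ Icc a b, 0 < g t := by
  by_contra! hcon
  obtain ⟨t₀, ht₀, hgt₀⟩ := hcon
  have hZ : IsCompact (Icc a b ∩ g ⁻¹' Iic 0) :=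
    isCompact_Icc.of_isClosed_subset (hg.preimage_isClosed_of_isClosed isClosed_Icc isClosed_Iic)
      inter_subset_left
  obtain ⟨r, ⟨hr, hgr⟩, hleast⟩ := hZ.exists_isLeast ⟨t₀, ht₀, hgt₀⟩
  have hbefore : ∀ s ∈ Ico a r, 0 < g s := fun s hs => by
    by_contra! hs0
    exact absurd (hleast ⟨⟨hs.1, hs.2.le.trans hr.2⟩, hs0⟩) (not_le.2 hs.2)
  have har : a < r := lt_of_le_of_ne hr.1 (fun h => by subst h; exact absurd hgr (not_le.2 ha))
  obtain ⟨s, hs, hgs⟩ := intermediate_value_Icc' har.le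
    (hg.mono (Icc_subset_Icc_right hr.2)) ⟨hgr, ha.le⟩
  have hrs : r = s := le_antisymm (hleast ⟨⟨hs.1, hs.2.trans hr.2⟩, hgs.le⟩) hs.2
  subst hrs
  exact hne r ⟨har, hr.2⟩ hbefore hgs

/-- Companion of `pos_of_no_first_zero`: a first zero is ruled out by showing that the derivative
there would be strictly positive. -/
lemma deriv_nonpos_of_pos_left {g : ℝ → ℝ} {d a r : ℝ} (har : a < r) (hd : HasDerivAt g d r)
    (hr : g r = 0) (hpos : ∀ s ∈ Ioo a r, 0 < g s) : d ≤ 0 := by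
  have h1 : Tendsto (slope g r) (𝓝[<] r) (𝓝 d) :=
    (hasDerivWithinAt_iff_tendsto_slope' self_notMem_Iio).1 hd.hasDerivWithinAt
  refine le_of_tendsto h1 ?_
  filter_upwards [Ioo_mem_nhdsLT har] with s hs
  rw [slope_def_field, hr, sub_zero]
  exact div_nonpos_of_nonneg_of_nonpos (hpos s hs).le (by linarith [hs.2])

end Calculus

/-! ### The energy and its level 1/4 -/

lemma energy_eq (x y : ℝ) : energy (x, y) = 1 / 4 - (1 - x ^ 2) ^ 2 / 4 + y ^ 2 / 2 := by
  simp only [energy]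
  ring

lemma energy_neg (x y : ℝ) : energy (-x, -y) = energy (x, y) := by
  simp only [energy]
  ring

lemma continuous_energy : Continuous energy := by
  unfold energy
  fun_prop

/-- The completed square gives y² ≥ (1−x²)²/2; the constant 1/√2 is weakened to 1/2, which suffices
throughout. -/
lemma half_le_of_energy {x y : ℝ} (hE : 1 / 4 ≤ energy (x, y)) (hy : 0 ≤ y) :
    |1 - x ^ 2| / 2 ≤ y := by
  rw [energy_eq] at hE
  have h1 : |1 - x ^ 2| ^ 2 = (1 - x ^ 2) ^ 2 := sq_abs _
  have h2 := abs_nonneg (1 - x ^ 2)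
  nlinarith

/-- The energy is at least 1/4 on the lines x = ±1, so they separate the sublevel set into three
regions that trajectories cannot leave. -/
lemma sq_ne_one_of_energy_lt {x y : ℝ} (hE : energy (x, y) < 1 / 4) : x ^ 2 ≠ 1 := fun h => by
  rw [energy_eq, h] at hE
  nlinarith [sq_nonneg y]

/-! ### Energy dissipation and invariant regions -/

section Solution

variable {γ u₀ u₁ : ℝ} {T : EReal} {u v : ℝ → ℝ}

namespace IsSolutionOn

/-- The odd symmetry of the equation transfers results for u > 1 to u < −1. -/
lemma neg (h : IsSolutionOn γ u₀ u₁ T u v) :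
    IsSolutionOn γ (-u₀) (-u₁) T (fun t => -u t) (fun t => -v t) where
  pos := h.pos
  init := by simp [h.init]
  init_deriv := by simp [h.init_deriv]
  hasDeriv t ht := (h.hasDeriv t ht).fun_neg
  hasDeriv_deriv t ht := (h.hasDeriv_deriv t ht).fun_neg.congr_deriv (by ring)

variable (h : IsSolutionOn γ u₀ u₁ T u v)
include h

lemma continuousOn_fst {a b : ℝ} (ha : 0 ≤ a) (hb : b ∈ timeInterval T) :
    ContinuousOn u (Icc a b) := (h.continuousOn_pair ha hb).fst

lemma continuousOn_snd {a b : ℝ} (ha : 0 ≤ a) (hb : b ∈ timeInterval T) :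
    ContinuousOn v (Icc a b) := (h.continuousOn_pair ha hb).snd

lemma hasDerivAt_fst {t : ℝ} (ht : t ∈ timeInterval T) (h0 : 0 < t) : HasDerivAt u (v t) t :=
  (h.hasDeriv t ht).hasDerivAt (Ici_mem_nhds h0)

lemma hasDerivAt_snd {t : ℝ} (ht : t ∈ timeInterval T) (h0 : 0 < t) :
    HasDerivAt v (u t ^ 3 - u t - γ * v t) t :=
  (h.hasDeriv_deriv t ht).hasDerivAt (Ici_mem_nhds h0)

lemma hasDeriv_of_mem {a b : ℝ} (ha : 0 ≤ a) (hb : b ∈ timeInterval T) :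
    ∀ t ∈ Icc a b, HasDerivWithinAt u (v t) (Ici 0) t := fun t ht =>
  h.hasDeriv t (mem_timeInterval_of_le hb (ha.trans ht.1) ht.2)

lemma hasDeriv_deriv_of_mem {a b : ℝ} (ha : 0 ≤ a) (hb : b ∈ timeInterval T) :
    ∀ t ∈ Icc a b, HasDerivWithinAt v (u t ^ 3 - u t - γ * v t) (Ici 0) t := fun t ht =>
  h.hasDeriv_deriv t (mem_timeInterval_of_le hb (ha.trans ht.1) ht.2)

lemma hasDeriv_energy {t : ℝ} (ht : t ∈ timeInterval T) :
    HasDerivWithinAt (fun t => energy (u t, v t)) (-γ * v t ^ 2) (Ici 0) t := by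
  have hu := h.hasDeriv t ht
  have hv := h.hasDeriv_deriv t ht
  simp only [energy]
  refine ((((hu.fun_pow 2).div_const 2).fun_sub ((hu.fun_pow 4).div_const 4)).fun_add
    ((hv.fun_pow 2).div_const 2)).congr_deriv ?_
  push_cast
  ring

lemma hasDeriv_energy_of_mem {a b : ℝ} (ha : 0 ≤ a) (hb : b ∈ timeInterval T) :
    ∀ t ∈ Icc a b, HasDerivWithinAt (fun t => energy (u t, v t)) (-γ * v t ^ 2) (Ici 0) t :=
  fun _ ht => h.hasDeriv_energy (mem_timeInterval_of_le hb (ha.trans ht.1) ht.2)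

lemma energy_le (hγ : 0 ≤ γ) {s t : ℝ} (hs : 0 ≤ s) (hst : s ≤ t) (ht : t ∈ timeInterval T) :
    energy (u t, v t) ≤ energy (u s, v s) :=
  le_of_deriv_nonpos hs hst (h.hasDeriv_energy_of_mem hs ht) fun r _ => by
    have := sq_nonneg (v r)
    nlinarith

lemma energy_le_init (hγ : 0 ≤ γ) {t : ℝ} (ht : t ∈ timeInterval T) :
    energy (u t, v t) ≤ energy (u₀, u₁) := by
  have := h.energy_le hγ le_rfl ht.1 ht
  rwa [h.init, h.init_deriv] at this

lemma energy_eq_init (hγ : γ = 0) {t : ℝ} (ht : t ∈ timeInterval T) :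
    energy (u t, v t) = energy (u₀, u₁) := by
  refine le_antisymm (h.energy_le_init hγ.ge ht) ?_
  have := add_mul_le_of_le_deriv (m := 0) le_rfl ht.1 (h.hasDeriv_energy_of_mem le_rfl ht)
    (fun r _ => by rw [hγ]; simp)
  simpa [h.init, h.init_deriv] using this

lemma lt_of_snd_pos {a b : ℝ} (ha : 0 ≤ a) (hab : a < b) (hb : b ∈ timeInterval T)
    (hv : ∀ t ∈ Ioo a b, 0 < v t) : u a < u b :=
  lt_of_deriv_pos ha hab (h.hasDeriv_of_mem ha hb) hv

lemma le_of_snd_pos {a b : ℝ} (ha : 0 ≤ a) (hab : a ≤ b) (hb : b ∈ timeInterval T)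
    (hv : ∀ t ∈ Ioo a b, 0 < v t) : u a ≤ u b := by
  rcases hab.eq_or_lt with rfl | hab
  · exact le_rfl
  · exact (h.lt_of_snd_pos ha hab hb hv).le

/-- A trajectory which does not start at an equilibrium `(±1, 0)` does not reach it. -/
lemma snd_ne_zero (hu₁ : 0 < u₁) {t : ℝ} (ht : t ∈ timeInterval T) (hu : u t ^ 2 = 1) :
    v t ≠ 0 := by
  intro hv
  obtain ⟨R, hR0, hR⟩ := h.exists_bound ht
  obtain ⟨K, hK⟩ := exists_lipschitzWith_cutField hR0 γ
  have hfield : cutField R γ (u t, 0) = 0 := by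
    rw [cutField_of_norm_le (by simpa [hv] using hR t ⟨ht.1, le_rfl⟩)]
    ext
    · simp [field]
    · simp only [field, Prod.snd_zero]
      linear_combination u t * hu
  -- Backward uniqueness: the trajectory would coincide with the equilibrium on [0, t], contrary to
  -- v(0) = u₁ > 0.
  have heq := ODE_solution_unique_of_mem_Icc_left (v := fun _ => cutField R γ) (s := fun _ => univ)
    (K := K) (f := fun s => (u s, v s)) (g := fun _ => (u t, 0)) (a := 0) (b := t)
    (fun _ _ => hK.lipschitzOnWith) (h.continuousOn_pair le_rfl ht)
    (fun s hs => by
      rw [cutField_of_norm_le (hR s ⟨hs.1.le, hs.2⟩)]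
      exact ((h.hasDerivWithinAt_pair (mem_timeInterval_of_le ht hs.1.le hs.2)).hasDerivAt
        (Ici_mem_nhds hs.1)).hasDerivWithinAt)
    (fun _ _ => mem_univ _) continuousOn_const
    (fun s _ => by rw [hfield]; exact hasDerivWithinAt_const _ _ _)
    (fun _ _ => mem_univ _) (by simp [hv]) ⟨le_rfl, ht.1⟩
  simp only [Prod.mk.injEq, h.init_deriv] at heq
  linarith [heq.2]

/-- The region `u ≥ 1`, `v > 0` is forward invariant. -/
lemma snd_pos_of_one_le {t₁ t : ℝ} (ht₁ : 0 ≤ t₁) (hu : 1 ≤ u t₁) (hv : 0 < v t₁)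
    (ht : t ∈ timeInterval T) (h₁ : t₁ ≤ t) : 0 < v t := by
  refine pos_of_no_first_zero (h.continuousOn_snd ht₁ ht) hv (fun r hr hpos h0 => ?_) t ⟨h₁, le_rfl⟩
  have hrT : r ∈ timeInterval T := mem_timeInterval_of_le ht (ht₁.trans hr.1.le) hr.2
  have h1 := h.lt_of_snd_pos ht₁ hr.1 hrT fun s hs => hpos s ⟨hs.1.le, hs.2⟩
  have h2 := deriv_nonpos_of_pos_left hr.1 (h.hasDerivAt_snd hrT (ht₁.trans_lt hr.1)) h0
    fun s hs => hpos s ⟨hs.1.le, hs.2⟩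
  rw [h0] at h2
  -- At a zero of v the derivative of v is u(u²−1), which is positive since u > 1.
  nlinarith [mul_pos (by linarith : 0 < u r) (by nlinarith : 0 < u r ^ 2 - 1)]

lemma one_lt_of_one_le {t₁ t : ℝ} (ht₁ : 0 ≤ t₁) (hu : 1 ≤ u t₁) (hv : 0 < v t₁)
    (ht : t ∈ timeInterval T) (h₁ : t₁ < t) : 1 < u t :=
  hu.trans_lt (h.lt_of_snd_pos ht₁ h₁ ht fun _ hs =>
    h.snd_pos_of_one_le ht₁ hu hv (mem_timeInterval_of_le ht (ht₁.trans hs.1.le) hs.2.le) hs.1.le)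

lemma sq_lt_one_of_energy_lt (hγ : 0 ≤ γ) {t₁ t : ℝ} (ht₁ : 0 ≤ t₁) (hu : u t₁ ^ 2 < 1)
    (hE : energy (u t₁, v t₁) < 1 / 4) (ht : t ∈ timeInterval T) (h₁ : t₁ ≤ t) : u t ^ 2 < 1 := by
  have := pos_of_no_first_zero (g := fun s => 1 - u s ^ 2) (a := t₁) (b := t)
    (continuousOn_const.sub ((h.continuousOn_fst ht₁ ht).pow 2)) (by simpa using hu)
    (fun r hr _ h0 => ?_) t ⟨h₁, le_rfl⟩
  · simpa using this
  · have hrT : r ∈ timeInterval T := mem_timeInterval_of_le ht (ht₁.trans hr.1.le) hr.2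
    exact sq_ne_one_of_energy_lt ((h.energy_le hγ ht₁ hr.1.le hrT).trans_lt hE) (by linarith)

lemma one_lt_of_energy_lt (hγ : 0 ≤ γ) {t₁ t : ℝ} (ht₁ : 0 ≤ t₁) (hu : 1 < u t₁)
    (hE : energy (u t₁, v t₁) < 1 / 4) (ht : t ∈ timeInterval T) (h₁ : t₁ ≤ t) : 1 < u t := by
  have := pos_of_no_first_zero (g := fun s => u s - 1) (a := t₁) (b := t)
    ((h.continuousOn_fst ht₁ ht).sub continuousOn_const) (by simpa using hu)
    (fun r hr _ h0 => ?_) t ⟨h₁, le_rfl⟩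
  · simpa using this
  · have hrT : r ∈ timeInterval T := mem_timeInterval_of_le ht (ht₁.trans hr.1.le) hr.2
    exact sq_ne_one_of_energy_lt ((h.energy_le hγ ht₁ hr.1.le hrT).trans_lt hE)
      (by rw [show u r = 1 by linarith]; norm_num)

lemma lt_neg_one_of_energy_lt (hγ : 0 ≤ γ) {t₁ t : ℝ} (ht₁ : 0 ≤ t₁) (hu : u t₁ < -1)
    (hE : energy (u t₁, v t₁) < 1 / 4) (ht : t ∈ timeInterval T) (h₁ : t₁ ≤ t) : u t < -1 := by
  have := h.neg.one_lt_of_energy_lt hγ ht₁ (by linarith) (by rwa [energy_neg]) ht h₁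
  linarith

end IsSolutionOn

/-! ### Exclusion of global solutions -/

/-- There is no global solution which enters the region `u ≥ 1`, `v > 0`. -/
theorem IsSolutionOn.false_of_one_le (h : IsSolutionOn γ u₀ u₁ ⊤ u v) (hγ : 0 ≤ γ) {t₁ : ℝ}
    (ht₁ : 0 ≤ t₁) (hu : 1 ≤ u t₁) (hv : 0 < v t₁) : False := by
  have mem : ∀ {t : ℝ}, 0 ≤ t → t ∈ timeInterval ⊤ := fun ht => mem_timeInterval_top.2 ht
  -- A slightly later time makes u > 1 strict, so that u − 1 can be inverted.
  obtain ⟨t₂, ht₁₂⟩ : ∃ t₂, t₁ < t₂ := exists_gt t₁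
  have ht₂ : 0 ≤ t₂ := ht₁.trans ht₁₂.le
  have hgt : ∀ t, t₂ ≤ t → 1 < u t := fun t ht =>
    h.one_lt_of_one_le ht₁ hu hv (mem (ht₂.trans ht)) (ht₁₂.trans_le ht)
  have hv₂ := h.snd_pos_of_one_le ht₁ hu hv (mem ht₂) ht₁₂.le
  have hu₂ := hgt t₂ le_rfl
  -- The first bound gives κγ < 1/2 and κ ≤ 1/2, the second places the state at t₂ above the barrier
  -- v = κ(u²−1).
  obtain ⟨κ, hκ, hκγ, hκv⟩ : ∃ κ : ℝ, 0 < κ ∧ 2 * κ * (γ + 1) ≤ 1 ∧ κ * (u t₂) ^ 2 ≤ v t₂ := by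
    refine ⟨min (1 / (2 * (γ + 1))) (v t₂ / u t₂ ^ 2), by positivity, ?_, ?_⟩
    · have := min_le_left (1 / (2 * (γ + 1))) (v t₂ / u t₂ ^ 2)
      rw [le_div_iff₀ (by positivity)] at this
      linarith
    · have := min_le_right (1 / (2 * (γ + 1))) (v t₂ / u t₂ ^ 2)
      rwa [le_div_iff₀ (by positivity)] at this
  have hg : ∀ t, t₂ ≤ t → κ * (u t ^ 2 - 1) < v t := by
    intro t ht
    have hder : ∀ s ∈ Icc t₂ t, HasDerivWithinAt (fun s => v s - κ * (u s ^ 2 - 1))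
        (u s ^ 3 - u s - γ * v s - κ * (2 * u s * v s)) (Ici 0) s := fun s hs => by
      have hs' := mem (ht₂.trans hs.1)
      refine ((h.hasDeriv_deriv s hs').fun_sub
        ((((h.hasDeriv s hs').fun_pow 2).sub_const 1).const_mul κ)).congr_deriv ?_
      push_cast
      ring
    have := pos_of_no_first_zero (g := fun s => v s - κ * (u s ^ 2 - 1)) (a := t₂) (b := t)
      (fun s hs => (hder s hs).continuousWithinAt.mono fun r hr => ht₂.trans hr.1)
      (by nlinarith) (fun r hr hpos h0 => ?_) t ⟨ht, le_rfl⟩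
    · simpa using this
    · have h1 := deriv_nonpos_of_pos_left hr.1 ((hder r ⟨hr.1.le, hr.2⟩).hasDerivAt
        (Ici_mem_nhds (ht₂.trans_lt hr.1))) h0 fun s hs => hpos s ⟨hs.1.le, hs.2⟩
      have h2 : v r = κ * (u r ^ 2 - 1) := by linarith
      have h3 := hgt r hr.1.le
      rw [h2] at h1
      -- This is the derivative of v − κ(u²−1) evaluated on the barrier; its positivity forbids a
      -- first contact.
      have h4 : 0 < (u r ^ 2 - 1) * (u r - κ * γ - 2 * κ ^ 2 * u r) := by
        apply mul_pos (by nlinarith)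
        have h5 : κ * γ < 1 / 2 := by nlinarith
        have h6 : κ ≤ 1 / 2 := by nlinarith [mul_nonneg hκ.le hγ]
        have h7 : κ ^ 2 * u r ≤ 1 / 4 * u r := by gcongr; nlinarith
        linarith
      nlinarith
  -- Above the barrier z' = v/(u−1)² ≥ κ(u+1)/(u−1) ≥ κ, so the negative quantity z would become
  -- nonnegative by time t₂ − z(t₂)/κ.
  set z : ℝ → ℝ := fun t => -(u t - 1)⁻¹ with hz
  have hzt : ∀ t, t₂ ≤ t → z t₂ + κ * (t - t₂) ≤ z t := by
    intro t ht
    refine add_mul_le_of_le_deriv (f' := fun s => v s / (u s - 1) ^ 2) ht₂ ht (fun s hs => ?_)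
      (fun s hs => ?_)
    · have h1 : u s - 1 ≠ 0 := by linarith [hgt s hs.1]
      refine (((h.hasDeriv s (mem (ht₂.trans hs.1))).sub_const 1).fun_inv h1).fun_neg.congr_deriv ?_
      field_simp
    · have h1 := hgt s hs.1.le
      have h2 := hg s hs.1.le
      rw [le_div_iff₀ (by nlinarith)]
      nlinarith [mul_pos hκ (sub_pos.2 h1)]
  have hz2 : 0 ≤ -z t₂ := by
    simp only [hz, neg_neg]
    exact inv_nonneg.2 (by linarith)
  have h1 := hzt (t₂ + -z t₂ / κ) (by linarith [div_nonneg hz2 hκ.le])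
  have h2 : z (t₂ + -z t₂ / κ) < 0 := by
    have := hgt (t₂ + -z t₂ / κ) (by linarith [div_nonneg hz2 hκ.le])
    simp only [hz]
    rw [neg_lt_zero]
    exact inv_pos.2 (by linarith)
  have h3 : κ * (t₂ + -z t₂ / κ - t₂) = -z t₂ := by field_simp; ring
  linarith

/-- There is no global solution which enters the region `u > 1`, `E < 1/4`. -/
theorem IsSolutionOn.false_of_one_lt_of_energy_lt (h : IsSolutionOn γ u₀ u₁ ⊤ u v) (hγ : 0 ≤ γ)
    {t₁ : ℝ} (ht₁ : 0 ≤ t₁) (hu : 1 < u t₁) (hE : energy (u t₁, v t₁) < 1 / 4) : False := by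
  have mem : ∀ {t : ℝ}, 0 ≤ t → t ∈ timeInterval ⊤ := fun ht => mem_timeInterval_top.2 ht
  have hgt : ∀ t, t₁ ≤ t → 1 < u t := fun t ht =>
    h.one_lt_of_energy_lt hγ ht₁ hu hE (mem (ht₁.trans ht)) ht
  have hv : ∀ t, t₁ ≤ t → v t ≤ 0 := fun t ht => by
    by_contra! hv
    exact h.false_of_one_le hγ (ht₁.trans ht) (hgt t ht).le hv
  -- Since the energy does not increase, (u²−1)² ≥ 1 − 4E(t₁) = m². Thus u² − 1 ≥ m, and v ≤ 0 then
  -- gives v' ≥ m.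
  obtain ⟨m, hm, hm2⟩ : ∃ m > 0, m ^ 2 = 1 - 4 * energy (u t₁, v t₁) :=
    ⟨√(1 - 4 * energy (u t₁, v t₁)), Real.sqrt_pos.2 (by linarith), Real.sq_sqrt (by linarith)⟩
  have hlow : ∀ t, t₁ ≤ t → m ≤ u t ^ 3 - u t - γ * v t := fun t ht => by
    have h1 := hgt t ht
    have h2 := h.energy_le hγ ht₁ ht (mem (ht₁.trans ht))
    rw [energy_eq (u t)] at h2
    have h3 : m ≤ u t ^ 2 - 1 :=
      (sq_le_sq₀ hm.le (by nlinarith)).1 (by nlinarith [sq_nonneg (v t)])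
    nlinarith [hv t ht, mul_nonneg hγ (neg_nonneg.2 (hv t ht))]
  -- After time (1 − v(t₁))/m the linear lower bound for v equals 1, contradicting v ≤ 0.
  have hd : 0 ≤ (1 - v t₁) / m := div_nonneg (by linarith [hv t₁ le_rfl]) hm.le
  have h1 := add_mul_le_of_le_deriv (m := m) ht₁ (b := t₁ + (1 - v t₁) / m) (by linarith)
    (h.hasDeriv_deriv_of_mem ht₁ (mem (by linarith))) (fun t ht => hlow t ht.1.le)
  have h2 := hv (t₁ + (1 - v t₁) / m) (by linarith)
  have h3 : m * (t₁ + (1 - v t₁) / m - t₁) = 1 - v t₁ := by field_simp; ring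
  linarith

theorem IsSolutionOn.false_of_lt_neg_one_of_energy_lt (h : IsSolutionOn γ u₀ u₁ ⊤ u v)
    (hγ : 0 ≤ γ) {t₁ : ℝ} (ht₁ : 0 ≤ t₁) (hu : u t₁ < -1) (hE : energy (u t₁, v t₁) < 1 / 4) :
    False :=
  h.neg.false_of_one_lt_of_energy_lt hγ ht₁ (by linarith) (by rwa [energy_neg])

end Solution

/-! ### Crossing the saddle positions -/

section Solution

variable {γ u₀ u₁ : ℝ} {T : EReal} {u v : ℝ → ℝ}

namespace IsSolutionOn

/-- A crossing of the level `ℓ = ±1` from the left happens with positive velocity. -/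
theorem exists_crossing (h : IsSolutionOn γ u₀ u₁ T u v) (hγ : 0 ≤ γ) (hu₁ : 0 < u₁) {ℓ : ℝ}
    (hℓ : ℓ ^ 2 = 1) (hu₀ : u₀ < ℓ) {t₂ : ℝ} (ht₂ : t₂ ∈ timeInterval T) (hu₂ : ℓ < u t₂) :
    ∃ t₁ ∈ timeInterval T, 0 < t₁ ∧ t₁ < t₂ ∧ u t₁ = ℓ ∧ 1 / 4 < energy (u t₁, v t₁) ∧
      ∀ r ∈ Icc 0 t₁, 0 < v r := by
  have hcont := h.continuousOn_fst le_rfl ht₂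
  have hZ : IsCompact (Icc 0 t₂ ∩ u ⁻¹' Ici ℓ) :=
    isCompact_Icc.of_isClosed_subset (hcont.preimage_isClosed_of_isClosed isClosed_Icc isClosed_Ici)
      inter_subset_left
  obtain ⟨r, ⟨hr, hur⟩, hleast⟩ := hZ.exists_isLeast ⟨t₂, ⟨ht₂.1, le_rfl⟩, hu₂.le⟩
  have hbefore : ∀ s ∈ Ico 0 r, u s < ℓ := fun s hs => by
    by_contra! hs0
    exact absurd (hleast ⟨⟨hs.1, hs.2.le.trans hr.2⟩, hs0⟩) (not_le.2 hs.2)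
  have hr0 : 0 < r := lt_of_le_of_ne hr.1 fun h0 => by
    subst h0
    rw [mem_preimage, h.init] at hur
    exact absurd hur (not_le.2 hu₀)
  have hrT := mem_timeInterval_of_le ht₂ hr.1 hr.2
  obtain ⟨s, hs, hus⟩ := intermediate_value_Icc hr0.le (hcont.mono (Icc_subset_Icc_right hr.2))
    ⟨by rw [h.init]; exact hu₀.le, hur⟩
  obtain rfl : r = s := le_antisymm (hleast ⟨⟨hs.1, hs.2.trans hr.2⟩, hus.ge⟩) hs.2
  have hv0 : 0 ≤ v r := by
    have := deriv_nonpos_of_pos_left hr0 ((h.hasDerivAt_fst hrT hr0).const_sub ℓ)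
      (by rw [hus, sub_self]) fun s hs => sub_pos.2 (hbefore s ⟨hs.1.le, hs.2⟩)
    linarith
  have hv : 0 < v r := lt_of_le_of_ne hv0 (h.snd_ne_zero hu₁ hrT (by rw [hus, hℓ])).symm
  have hE : 1 / 4 < energy (u r, v r) := by
    rw [energy_eq, hus, hℓ]
    nlinarith
  refine ⟨r, hrT, hr0, lt_of_le_of_ne hr.2 fun h0 => ?_, hus, hE, ?_⟩
  · subst h0
    exact absurd hus hu₂.ne'
  -- Before r the energy is at least E(r) > 1/4, whereas a zero of v would force E ≤ 1/4.
  · refine pos_of_no_first_zero (h.continuousOn_snd le_rfl hrT) (by rwa [h.init_deriv])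
      fun s hs _ hs0 => ?_
    have := h.energy_le hγ hs.1.le hs.2 hrT
    rw [energy_eq (u s), hs0] at this
    nlinarith [sq_nonneg (1 - u s ^ 2)]

lemma exists_first_zero (h : IsSolutionOn γ u₀ u₁ T u v) {t₁ t : ℝ} (ht₁ : 0 ≤ t₁)
    (ht : t ∈ timeInterval T) (hv : 0 < v t₁) (hne : ¬ ∀ s ∈ Icc t₁ t, 0 < v s) :
    ∃ r ∈ Ioc t₁ t, (∀ s ∈ Ico t₁ r, 0 < v s) ∧ v r = 0 := by
  by_contra! hcon
  exact hne (pos_of_no_first_zero (h.continuousOn_snd ht₁ ht) hv hcon)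

/-- After crossing `-1` upwards the trajectory does not return below `-1`. -/
theorem neg_one_le (h : IsSolutionOn γ u₀ u₁ T u v) (hγ : 0 ≤ γ) (hu₁ : 0 < u₁) {t₁ t : ℝ}
    (ht₁ : 0 ≤ t₁) (hu : -1 ≤ u t₁) (hv : 0 < v t₁) (ht : t ∈ timeInterval T) (h₁ : t₁ ≤ t) :
    -1 ≤ u t := by
  by_contra! hlt
  obtain ⟨r, hr, hpos, hvr⟩ := h.exists_first_zero ht₁ ht hv fun hall => by
    have := h.le_of_snd_pos ht₁ h₁ ht fun s hs => hall s ⟨hs.1.le, hs.2.le⟩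
    linarith
  have hr0 : 0 ≤ r := ht₁.trans hr.1.le
  have hrT := mem_timeInterval_of_le ht hr0 hr.2
  have hur := h.lt_of_snd_pos ht₁ hr.1 hrT fun s hs => hpos s ⟨hs.1.le, hs.2⟩
  -- At the first turning point: inside (−1, 1) the energy is below 1/4 and traps the trajectory; 1
  -- would be an equilibrium; beyond 1 the velocity cannot vanish.
  rcases lt_trichotomy (u r) 1 with h1 | h1 | h1
  · have hsq : u r ^ 2 < 1 := by nlinarith
    have hE : energy (u r, v r) < 1 / 4 := by
      rw [energy_eq, hvr]
      nlinarith [mul_pos (sub_pos.2 hsq) (sub_pos.2 hsq)]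
    have := h.sq_lt_one_of_energy_lt hγ hr0 hsq hE ht hr.2
    nlinarith
  · exact h.snd_ne_zero hu₁ hrT (by rw [h1, one_pow]) hvr
  · obtain ⟨s, hs, hus⟩ : ∃ s ∈ Ico t₁ r, 1 ≤ u s := by
      rcases lt_or_ge (u t₁) 1 with h2 | h2
      · obtain ⟨s, hs, hus⟩ := intermediate_value_Ioo hr.1.le (h.continuousOn_fst ht₁ hrT) ⟨h2, h1⟩
        exact ⟨s, ⟨hs.1.le, hs.2⟩, hus.ge⟩
      · exact ⟨t₁, ⟨le_rfl, hr.1⟩, h2⟩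
    exact (h.snd_pos_of_one_le (ht₁.trans hs.1) hus (hpos s hs) hrT hs.2.le).ne' hvr

/-- Touching ℓ at a positive time would be a local maximum of u, hence an equilibrium, which
uniqueness excludes. -/
lemma lt_of_forall_le (h : IsSolutionOn γ u₀ u₁ T u v) (hu₁ : 0 < u₁) {ℓ : ℝ} (hℓ : ℓ ^ 2 = 1)
    (hu₀ : u₀ < ℓ) (hle : ∀ t ∈ timeInterval T, u t ≤ ℓ) : ∀ t ∈ timeInterval T, u t < ℓ := by
  intro t ht
  refine lt_of_le_of_ne (hle t ht) fun heq => ?_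
  rcases ht.1.eq_or_lt with rfl | h0
  · rw [h.init] at heq
    exact hu₀.ne heq
  · obtain ⟨b, htb, hb⟩ := exists_gt_mem_timeInterval ht
    have hmax : IsLocalMax u t := by
      filter_upwards [Ioo_mem_nhds h0 htb] with s hs
      rw [heq]
      exact hle s (mem_timeInterval_of_le hb hs.1.le hs.2.le)
    exact h.snd_ne_zero hu₁ ht (by rw [heq, hℓ])
      (hmax.hasDerivAt_eq_zero (h.hasDerivAt_fst ht h0))

/-- While the energy is at least `1/4`, the quantity `E + γ/2 · σ (u - u³/3)` is nonincreasing on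
`{σ (1 - u²) ≥ 0}`. -/
lemma energy_add_le (h : IsSolutionOn γ u₀ u₁ T u v) (hγ : 0 ≤ γ) (σ : ℝ) (hσ : |σ| = 1)
    {s t : ℝ} (hs : 0 ≤ s) (hst : s ≤ t) (ht : t ∈ timeInterval T)
    (hE : 1 / 4 ≤ energy (u t, v t)) (hv : ∀ r ∈ Icc s t, 0 < v r) :
    energy (u t, v t) + γ / 2 * (σ * (u t - u t ^ 3 / 3)) ≤
      energy (u s, v s) + γ / 2 * (σ * (u s - u s ^ 3 / 3)) := by
  refine le_of_deriv_nonpos (f := fun t => energy (u t, v t) + γ / 2 * (σ * (u t - u t ^ 3 / 3)))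
    (f' := fun t => -γ * v t ^ 2 + γ / 2 * (σ * (v t - u t ^ 2 * v t))) hs hst (fun r hr => ?_)
    (fun r hr => ?_)
  · have hrT := mem_timeInterval_of_le ht (hs.trans hr.1) hr.2
    have hu := h.hasDeriv r hrT
    refine ((h.hasDeriv_energy hrT).fun_add
      (((hu.fun_sub ((hu.fun_pow 3).div_const 3)).const_mul σ).const_mul (γ / 2))).congr_deriv ?_
    push_cast
    ring
  · have hrT := mem_timeInterval_of_le ht (hs.trans hr.1.le) hr.2.le
    have hvr := hv r ⟨hr.1.le, hr.2.le⟩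
    -- As v ≥ |1−u²|/2, energy is lost at a rate of at least γ/2·|1−u²| per unit of distance, which
    -- dominates the correction term for either sign σ.
    have h1 := half_le_of_energy (hE.trans (h.energy_le hγ (hs.trans hr.1.le) hr.2.le ht)) hvr.le
    have h2 : σ * (1 - u r ^ 2) ≤ 2 * v r := by
      calc σ * (1 - u r ^ 2) ≤ |σ * (1 - u r ^ 2)| := le_abs_self _
        _ = |1 - u r ^ 2| := by rw [abs_mul, hσ, one_mul]
        _ ≤ _ := by linarith
    have h3 : γ * v r * (σ * (1 - u r ^ 2)) ≤ γ * v r * (2 * v r) :=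
      mul_le_mul_of_nonneg_left h2 (mul_nonneg hγ hvr.le)
    nlinarith

/-- The energy bound turns a bound on u into one on v, so continuation only requires control of the
position. -/
lemma abs_snd_le (h : IsSolutionOn γ u₀ u₁ T u v) (hγ : 0 ≤ γ) {R t : ℝ}
    (ht : t ∈ timeInterval T) (hR : |u t| ≤ R) :
    |v t| ≤ 2 * energy (u₀, u₁) + R ^ 4 / 2 + 1 := by
  have h1 := h.energy_le_init hγ ht
  have h2 : u t ^ 4 ≤ R ^ 4 := by
    rw [← (by decide : Even 4).pow_abs (u t)]
    exact pow_le_pow_left₀ (abs_nonneg _) hR 4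
  have h3 : v t ^ 2 ≤ 2 * energy (u₀, u₁) + R ^ 4 / 2 := by
    rw [show energy (u t, v t) = u t ^ 2 / 2 - u t ^ 4 / 4 + v t ^ 2 / 2 from rfl] at h1
    nlinarith [sq_nonneg (u t)]
  have h4 := sq_nonneg (v t)
  exact abs_le_of_sq_le_sq (by nlinarith) (by linarith)

end IsSolutionOn

namespace IsMaximalSolution

lemma eq_top_of_fst_bounded (h : IsMaximalSolution γ u₀ u₁ T u v) (hγ : 0 ≤ γ) {R : ℝ}
    (hR : ∀ t ∈ timeInterval T, |u t| ≤ R) : T = ⊤ :=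
  h.eq_top_of_bounded (R := max R (2 * energy (u₀, u₁) + R ^ 4 / 2 + 1)) fun t ht =>
    ⟨(hR t ht).trans (le_max_left _ _),
      (h.isSolutionOn.abs_snd_le hγ ht (hR t ht)).trans (le_max_right _ _)⟩

lemma eq_top_of_eventually_bounded (h : IsMaximalSolution γ u₀ u₁ T u v) (hγ : 0 ≤ γ) {t₁ R : ℝ}
    (ht₁ : t₁ ∈ timeInterval T) (hR : ∀ t ∈ timeInterval T, t₁ ≤ t → |u t| ≤ R) : T = ⊤ := by
  obtain ⟨R', -, hR'⟩ := h.isSolutionOn.exists_bound ht₁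
  refine h.eq_top_of_fst_bounded hγ (R := max R R') fun t ht => ?_
  rcases le_total t₁ t with h1 | h1
  · exact (hR t ht h1).trans (le_max_left _ _)
  · exact ((norm_fst_le (u t, v t)).trans (hR' t ⟨ht.1, h1⟩)).trans (le_max_right _ _)

lemma blowsUp_of_one_le (h : IsMaximalSolution γ u₀ u₁ T u v) (hγ : 0 ≤ γ) {t₁ : ℝ}
    (ht₁ : t₁ ∈ timeInterval T) (hu : 1 ≤ u t₁) (hv : 0 < v t₁) : BlowsUp T :=
  lt_top_iff_ne_top.2 fun hT => by
    subst hT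
    exact h.isSolutionOn.false_of_one_le hγ ht₁.1 hu hv

lemma blowsUp_of_lt_neg_one (h : IsMaximalSolution γ u₀ u₁ T u v) (hγ : 0 ≤ γ) {t₁ : ℝ}
    (ht₁ : t₁ ∈ timeInterval T) (hu : u t₁ < -1) (hE : energy (u t₁, v t₁) < 1 / 4) : BlowsUp T :=
  lt_top_iff_ne_top.2 fun hT => by
    subst hT
    exact h.isSolutionOn.false_of_lt_neg_one_of_energy_lt hγ ht₁.1 hu hE

/-- With positive damping, solutions starting from `𝒩₁` enter `𝒦⁻`. -/
theorem enters_setKMinus (h : IsMaximalSolution γ u₀ u₁ T u v) (hγ : 0 < γ) (hu₀ : 1 ≤ u₀)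
    (hu₁ : 0 < u₁) : Enters T u v (setKMinus ∩ {p | 1 < p.1}) := by
  have hsol := h.isSolutionOn
  have hu0 : 1 ≤ u 0 := by rwa [hsol.init]
  have hv0 : 0 < v 0 := by rwa [hsol.init_deriv]
  have hv : ∀ t ∈ timeInterval T, 0 < v t := fun t ht =>
    hsol.snd_pos_of_one_le le_rfl hu0 hv0 ht ht.1
  by_contra hcon
  have hE : ∀ t ∈ timeInterval T, 1 / 4 ≤ energy (u t, v t) := by
    intro t ht
    by_contra! hE
    -- At t itself u = 1 is not yet excluded; a later time gives u > 1 strictly.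
    obtain ⟨b, htb, hb⟩ := exists_gt_mem_timeInterval ht
    have hub := hsol.one_lt_of_one_le le_rfl hu0 hv0 hb (ht.1.trans_lt htb)
    exact hcon ⟨b, hb, ⟨(hsol.energy_le hγ.le ht.1 htb.le hb).trans_lt hE,
      lt_of_lt_of_le hub (le_abs_self _)⟩, hub⟩
  have hle : ∀ t ∈ timeInterval T, u₀ ≤ u t := fun t ht => by
    have := hsol.le_of_snd_pos le_rfl ht.1 ht fun s hs =>
      hv s (mem_timeInterval_of_le ht hs.1.le hs.2.le)
    rwa [hsol.init] at this
  -- The dissipation estimate with σ = −1 gives u³/3 − u ≤ M. Since u³/3 − u > 2u for u > 3, the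
  -- solution would be bounded and hence global, contrary to blow-up.
  set M := (energy (u₀, u₁) - 1 / 4) * (2 / γ) + (u₀ ^ 3 / 3 - u₀) with hM
  have hbound : ∀ t ∈ timeInterval T, u t ^ 3 / 3 - u t ≤ M := by
    intro t ht
    have h1 := hsol.energy_add_le hγ.le (-1) (by simp) le_rfl ht.1 ht (hE t ht) fun r hr =>
      hv r (mem_timeInterval_of_le ht hr.1 hr.2)
    rw [hsol.init, hsol.init_deriv] at h1
    have h2 : γ / 2 * (u t ^ 3 / 3 - u t) ≤ γ / 2 * M := by
      have : γ / 2 * M = energy (u₀, u₁) - 1 / 4 + γ / 2 * (u₀ ^ 3 / 3 - u₀) := by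
        rw [hM]
        field_simp
      rw [this]
      linarith [hE t ht]
    exact le_of_mul_le_mul_left h2 (by positivity)
  have hT : T = ⊤ := by
    refine h.eq_top_of_fst_bounded hγ.le (R := |M| + 3) fun t ht => ?_
    have h1 := hle t ht
    have h2 := hbound t ht
    have h3 := le_abs_self M
    rw [abs_of_pos (by linarith)]
    by_contra! h4
    have h5 : 3 < u t := by linarith [abs_nonneg M]
    nlinarith [mul_pos (sub_pos.2 h5) (sub_pos.2 h5)]
  exact (h.blowsUp_of_one_le hγ.le hsol.zero_mem hu0 hv0).ne hT

end IsMaximalSolution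

/-! ### Exponential convergence -/

lemma tendsto_mul_exp_neg_atTop (C : ℝ) {c : ℝ} (hc : 0 < c) :
    Tendsto (fun t => C * Real.exp (-c * t)) atTop (𝓝 0) := by
  rw [← mul_zero C]
  refine (Real.tendsto_exp_neg_atTop_nhds_zero.comp
    (tendsto_id.const_mul_atTop hc)).const_mul C |>.congr fun t => ?_
  simp

lemma ConvergesExponentially.tendsto {q : ℝ × ℝ} (h : ConvergesExponentially T u v q) :
    Tendsto (fun t => (u t, v t)) atTop (𝓝 q) := by
  obtain ⟨-, C, c, -, hc, hbound⟩ := h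
  rw [tendsto_iff_norm_sub_tendsto_zero]
  refine squeeze_zero' (Eventually.of_forall fun _ => norm_nonneg _) ?_
    (tendsto_mul_exp_neg_atTop C hc)
  filter_upwards [eventually_ge_atTop 0] with t ht using hbound t ht

lemma ConvergesExponentially.tendsto_energy {ℓ : ℝ} (hℓ : ℓ ^ 2 = 1)
    (h : ConvergesExponentially T u v (ℓ, 0)) :
    Tendsto (fun t => energy (u t, v t)) atTop (𝓝 (1 / 4)) := by
  have h2 : energy (ℓ, 0) = 1 / 4 := by rw [energy_eq, hℓ]; norm_num
  rw [← h2]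
  exact (continuous_energy.tendsto _).comp h.tendsto

/-- On the initial compact interval the trajectory is bounded and the exponential is bounded below,
so enlarging the constant suffices. -/
lemma convergesExponentially_of_tail (h : IsSolutionOn γ u₀ u₁ ⊤ u v) {q : ℝ × ℝ} {C c t₁ : ℝ}
    (hc : 0 < c) (hC : 0 ≤ C)
    (ht : ∀ t, t₁ ≤ t → 0 ≤ t → ‖(u t, v t) - q‖ ≤ C * Real.exp (-c * t)) :
    ConvergesExponentially ⊤ u v q := by
  obtain ⟨R, hR0, hR⟩ := h.exists_bound (b := max t₁ 0) (mem_timeInterval_top.2 (le_max_right _ _))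
  refine ⟨rfl, (R + ‖q‖) * Real.exp (c * max t₁ 0) + C + 1, c, by positivity, hc, fun t h0 => ?_⟩
  rcases le_total t₁ t with h1 | h1
  · refine (ht t h1 h0).trans ?_
    gcongr
    have : 0 ≤ (R + ‖q‖) * Real.exp (c * max t₁ 0) := by positivity
    linarith
  · have htm : t ≤ max t₁ 0 := h1.trans (le_max_left _ _)
    calc ‖(u t, v t) - q‖ ≤ R + ‖q‖ := (norm_sub_le _ _).trans (by gcongr; exact hR t ⟨h0, htm⟩)
      _ ≤ (R + ‖q‖) * Real.exp (c * max t₁ 0 + -c * t) := by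
        have : 1 ≤ Real.exp (c * max t₁ 0 + -c * t) := Real.one_le_exp (by nlinarith)
        nlinarith [norm_nonneg q]
      _ = (R + ‖q‖) * Real.exp (c * max t₁ 0) * Real.exp (-c * t) := by
        rw [Real.exp_add, mul_assoc]
      _ ≤ _ := by
        gcongr
        linarith

/-- With positive damping, solutions entering `𝒦⁺` converge to the origin exponentially. -/
theorem IsMaximalSolution.convergesExponentially_zero (h : IsMaximalSolution γ u₀ u₁ T u v)
    (hγ : 0 < γ) {t₁ : ℝ} (ht₁ : t₁ ∈ timeInterval T) (hu : u t₁ ^ 2 < 1)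
    (hE : energy (u t₁, v t₁) < 1 / 4) : ConvergesExponentially T u v (0, 0) := by
  have hsol := h.isSolutionOn
  have hlt : ∀ t ∈ timeInterval T, t₁ ≤ t → u t ^ 2 < 1 := fun t ht h1 =>
    hsol.sq_lt_one_of_energy_lt hγ.le ht₁.1 hu hE ht h1
  obtain rfl : T = ⊤ := h.eq_top_of_eventually_bounded hγ.le ht₁ (R := 1) fun t ht h1 =>
    abs_le_of_sq_le_sq (by linarith [hlt t ht h1]) one_pos.le
  have mem : ∀ {t : ℝ}, t₁ ≤ t → t ∈ timeInterval ⊤ := fun ht =>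
    mem_timeInterval_top.2 (ht₁.1.trans ht)
  obtain ⟨δ, hδ, hδ2⟩ : ∃ δ > 0, δ ^ 2 = 1 - 4 * energy (u t₁, v t₁) :=
    ⟨√(1 - 4 * energy (u t₁, v t₁)), Real.sqrt_pos.2 (by linarith), Real.sq_sqrt (by linarith)⟩
  have hδu : ∀ t, t₁ ≤ t → δ ≤ 1 - u t ^ 2 := fun t h1 => by
    have h2 := hsol.energy_le hγ.le ht₁.1 h1 (mem h1)
    rw [energy_eq (u t)] at h2
    exact (sq_le_sq₀ hδ.le (by linarith [hlt t (mem h1) h1])).1 (by nlinarith [sq_nonneg (v t)])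
  -- The constant k collects the v² term of (uv)' and the γ²/(2δ) from Young's inequality applied to
  -- γuv. Then ε ≤ 1/4 makes L comparable to u² + v², and εk ≤ γ/2 preserves half of the
  -- dissipation.
  set k := 1 + γ ^ 2 / (2 * δ) with hk
  have hk0 : 0 < k := by positivity
  set ε := min (1 / 4) (γ / (2 * k)) with hε
  have hε0 : 0 < ε := by positivity
  have hε1 : ε ≤ 1 / 4 := min_le_left _ _
  have hε2 : ε * k ≤ γ / 2 := by
    have : ε ≤ γ / (2 * k) := min_le_right _ _
    rw [le_div_iff₀ (by positivity)] at this
    linarith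
  set c := min (γ / 2) (ε * δ / 2) with hc
  have hc0 : 0 < c := by positivity
  -- The energy dissipates only v²; the cross term supplies the missing decay in u, using u² − u⁴ ≥
  -- δu².
  set L : ℝ → ℝ := fun t => energy (u t, v t) + ε * (u t * v t) with hL
  have hder : ∀ t, t₁ ≤ t → HasDerivWithinAt L
      (-γ * v t ^ 2 + ε * (v t * v t + u t * (u t ^ 3 - u t - γ * v t))) (Ici 0) t := fun t h1 =>
    (hsol.hasDeriv_energy (mem h1)).fun_add
      (((hsol.hasDeriv t (mem h1)).fun_mul (hsol.hasDeriv_deriv t (mem h1))).const_mul ε)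
  have hup : ∀ t, L t ≤ u t ^ 2 + v t ^ 2 := fun t => by
    simp only [hL, energy]
    have h1 : u t * v t ≤ (u t ^ 2 + v t ^ 2) / 2 := by nlinarith [sq_nonneg (u t - v t)]
    have h2 : ε * (u t * v t) ≤ ε * ((u t ^ 2 + v t ^ 2) / 2) := by gcongr
    have h3 : ε * ((u t ^ 2 + v t ^ 2) / 2) ≤ 1 / 4 * ((u t ^ 2 + v t ^ 2) / 2) := by gcongr
    have h4 : 0 ≤ u t ^ 4 := by positivity
    nlinarith [sq_nonneg (u t), sq_nonneg (v t)]
  have hlow : ∀ t, t₁ ≤ t → (u t ^ 2 + v t ^ 2) / 8 ≤ L t := fun t h1 => by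
    simp only [hL, energy]
    have h2 : -((u t ^ 2 + v t ^ 2) / 2) ≤ u t * v t := by nlinarith [sq_nonneg (u t + v t)]
    have h3 : ε * (-((u t ^ 2 + v t ^ 2) / 2)) ≤ ε * (u t * v t) := by gcongr
    have h4 : ε * ((u t ^ 2 + v t ^ 2) / 2) ≤ 1 / 4 * ((u t ^ 2 + v t ^ 2) / 2) := by gcongr
    have h5 : u t ^ 4 ≤ u t ^ 2 := by
      nlinarith [mul_nonneg (sq_nonneg (u t)) (sub_nonneg.2 (hlt t (mem h1) h1).le)]
    nlinarith [sq_nonneg (u t), sq_nonneg (v t)]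
  have hdecay : ∀ t, t₁ ≤ t →
      -γ * v t ^ 2 + ε * (v t * v t + u t * (u t ^ 3 - u t - γ * v t)) ≤ -c * L t := by
    intro t h1
    have h2 : -(γ * (u t * v t)) ≤ δ / 2 * u t ^ 2 + γ ^ 2 / (2 * δ) * v t ^ 2 := by
      have : δ / 2 * u t ^ 2 + γ ^ 2 / (2 * δ) * v t ^ 2 + γ * (u t * v t) =
          (δ * u t + γ * v t) ^ 2 / (2 * δ) := by
        field_simp
        ring
      have h3 : 0 ≤ (δ * u t + γ * v t) ^ 2 / (2 * δ) := by positivity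
      linarith
    have h3 : δ * u t ^ 2 ≤ (1 - u t ^ 2) * u t ^ 2 := by
      gcongr
      exact hδu t h1
    have h4 : v t * v t + u t * (u t ^ 3 - u t - γ * v t) ≤ k * v t ^ 2 - δ / 2 * u t ^ 2 := by
      rw [hk]
      nlinarith
    have h5 : ε * (v t * v t + u t * (u t ^ 3 - u t - γ * v t)) ≤
        ε * (k * v t ^ 2 - δ / 2 * u t ^ 2) := by gcongr
    have h6 : ε * k * v t ^ 2 ≤ γ / 2 * v t ^ 2 := by gcongr
    have h7 : c * L t ≤ c * (u t ^ 2 + v t ^ 2) := by gcongr; exact hup t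
    have h8 : c * v t ^ 2 ≤ γ / 2 * v t ^ 2 := by gcongr; exact min_le_left _ _
    have h9 : c * u t ^ 2 ≤ ε * δ / 2 * u t ^ 2 := by gcongr; exact min_le_right _ _
    linarith
  set M := 8 * (L t₁ * Real.exp (c * t₁)) with hM
  have hM0 : 0 ≤ M := by
    have := hlow t₁ le_rfl
    have : 0 ≤ L t₁ := le_trans (by positivity) this
    positivity
  refine convergesExponentially_of_tail hsol (C := M + 1) (c := c / 2) (t₁ := t₁) (by positivity)
    (by positivity) fun t h1 _ => ?_
  have h2 := le_mul_exp_of_deriv_le ht₁.1 h1 (fun s hs => hder s hs.1) fun s hs =>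
    hdecay s hs.1.le
  have h3 := hlow t h1
  -- Taking the square root halves the rate, and (M + 1)² ≥ M avoids √M.
  have h4 : u t ^ 2 + v t ^ 2 ≤ ((M + 1) * Real.exp (-(c / 2) * t)) ^ 2 := by
    have h5 : Real.exp (-c * t) = Real.exp (-(c / 2) * t) ^ 2 := by
      rw [← Real.exp_nat_mul]
      congr 1
      push_cast
      ring
    rw [mul_pow, ← h5]
    have h6 := Real.exp_pos (-c * t)
    have h7 : M * Real.exp (-c * t) ≤ (M + 1) ^ 2 * Real.exp (-c * t) := by
      gcongr
      nlinarith
    rw [hM] at h7 ⊢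
    linarith
  rw [show ((0 : ℝ), (0 : ℝ)) = 0 from rfl, sub_zero]
  have h5 : 0 ≤ (M + 1) * Real.exp (-(c / 2) * t) := by positivity
  exact max_le (abs_le_of_sq_le_sq (by nlinarith [sq_nonneg (v t)]) h5)
    (abs_le_of_sq_le_sq (by nlinarith [sq_nonneg (u t)]) h5)

/-- Convergence to a saddle `(ℓ, 0)` from the left at an exponential rate. -/
theorem IsMaximalSolution.convergesExponentially_of_le (h : IsMaximalSolution γ u₀ u₁ T u v)
    (hγ : 0 ≤ γ) {ℓ κ c t₁ : ℝ} (hc : 0 < c) (hκ : κ < ℓ)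
    (hneg : ∀ x, κ ≤ x → x < ℓ → x ^ 3 - x ≤ 0) (ht₁ : t₁ ∈ timeInterval T)
    (hlt : ∀ t ∈ timeInterval T, t₁ ≤ t → u t < ℓ)
    (hv : ∀ t ∈ timeInterval T, t₁ ≤ t → 0 < v t)
    (hle : ∀ t ∈ timeInterval T, t₁ ≤ t → c * (ℓ - u t) ≤ v t) :
    ConvergesExponentially T u v (ℓ, 0) := by
  have hsol := h.isSolutionOn
  have hmono : ∀ {s t}, t₁ ≤ s → s ≤ t → t ∈ timeInterval T → u s ≤ u t := fun hs hst ht =>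
    hsol.le_of_snd_pos (ht₁.1.trans hs) hst ht fun r hr =>
      hv r (mem_timeInterval_of_le ht (ht₁.1.trans (hs.trans hr.1.le)) hr.2.le) (hs.trans hr.1.le)
  obtain rfl : T = ⊤ := h.eq_top_of_eventually_bounded hγ ht₁ (R := max |u t₁| |ℓ|)
    fun t ht h1 => abs_le_max_abs_abs (hmono le_rfl h1 ht) (hlt t ht h1).le
  have mem : ∀ {t : ℝ}, t₁ ≤ t → t ∈ timeInterval ⊤ := fun ht =>
    mem_timeInterval_top.2 (ht₁.1.trans ht)
  set C := (ℓ - u t₁) * Real.exp (c * t₁) with hC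
  have hC0 : 0 < C := mul_pos (sub_pos.2 (hlt t₁ ht₁ le_rfl)) (Real.exp_pos _)
  have hdecay : ∀ t, t₁ ≤ t → ℓ - u t ≤ C * Real.exp (-c * t) := fun t h1 =>
    le_mul_exp_of_deriv_le (f := fun t => ℓ - u t) (f' := fun t => -v t) ht₁.1 h1
      (fun s hs => (hsol.hasDeriv s (mem hs.1)).const_sub ℓ)
      (fun s hs => by linarith [hle s (mem hs.1.le) hs.1.le])
  -- From t₂ on u ≥ κ, where u³ − u ≤ 0, so v is nonincreasing.
  obtain ⟨t₂, ht₁₂, ht₂⟩ : ∃ t₂, t₁ ≤ t₂ ∧ κ ≤ u t₂ := by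
    have h1 := tendsto_mul_exp_neg_atTop C hc
    obtain ⟨t₂, h2, h3⟩ := ((h1.eventually_lt_const (sub_pos.2 hκ)).and
      (eventually_ge_atTop t₁)).exists
    exact ⟨t₂, h3, by linarith [hdecay t₂ h3]⟩
  refine convergesExponentially_of_tail hsol (C := C * Real.exp c) (c := c) (t₁ := t₂ + 1) hc
    (by positivity) fun t h1 _ => ?_
  have hexp : Real.exp c * Real.exp (-c * t) = Real.exp (-c * (t - 1)) := by
    rw [← Real.exp_add]
    congr 1
    ring
  have ht : t₁ ≤ t := by linarith
  -- A nonincreasing v is at most its mean over [t−1, t], that is u(t) − u(t−1), so v inherits the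
  -- decay of ℓ − u.
  have h2 : v t ≤ ℓ - u (t - 1) := by
    have h3 := add_mul_le_of_le_deriv (m := v t) (f := u) (f' := v) (a := t - 1) (b := t)
      (by linarith [ht₁.1]) (by linarith)
      (hsol.hasDeriv_of_mem (by linarith [ht₁.1]) (mem ht)) (fun s hs => ?_)
    · linarith [hlt t (mem ht) ht]
    · have hs1 : t₁ ≤ s := by linarith [hs.1]
      refine le_of_deriv_nonpos (ht₁.1.trans hs1) hs.2.le
        (hsol.hasDeriv_deriv_of_mem (ht₁.1.trans hs1) (mem ht)) fun r hr => ?_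
      have hr1 : t₁ ≤ r := hs1.trans hr.1.le
      have h4 := hneg (u r) (ht₂.trans (hmono ht₁₂ (by linarith [hs.1, hr.1]) (mem hr1)))
        (hlt r (mem hr1) hr1)
      have h5 := mul_nonneg hγ (hv r (mem hr1) hr1).le
      linarith
  have h3 : v t ≤ C * Real.exp c * Real.exp (-c * t) := by
    rw [mul_assoc, hexp]
    exact h2.trans (hdecay _ (by linarith))
  have h4 : ℓ - u t ≤ C * Real.exp c * Real.exp (-c * t) := by
    refine (hdecay t ht).trans ?_
    gcongr
    exact le_mul_of_one_le_right hC0.le (Real.one_le_exp hc.le)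
  refine max_le ?_ ?_
  · simp only [Prod.fst_sub, Real.norm_eq_abs]
    rwa [abs_sub_comm, abs_of_pos (sub_pos.2 (hlt t (mem ht) ht))]
  · simpa [abs_of_pos (hv t (mem ht) ht)] using h3

/-! ### Sweeping up to a saddle and convergence to it -/

/-- The trajectory passes over all positions in `[u₀, ℓ)` with positive velocity and energy at least
`1/4`. -/
def Sweeps (ℓ : ℝ) (T : EReal) (u v : ℝ → ℝ) : Prop :=
  ∀ x, u 0 ≤ x → x < ℓ → ∃ s ∈ timeInterval T, u s = x ∧ 1 / 4 ≤ energy (u s, v s) ∧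
    ∀ r ∈ Icc 0 s, 0 < v r

/-- Crossing ℓ and converging to (ℓ, 0) look alike from positions below ℓ; `Sweeps` records what
they share, which is all that the comparison uses. -/
lemma IsSolutionOn.sweeps_of_lt (h : IsSolutionOn γ u₀ u₁ T u v) (hγ : 0 ≤ γ) (hu₁ : 0 < u₁)
    {ℓ : ℝ} (hℓ : ℓ ^ 2 = 1) (hu₀ : u₀ < ℓ) {t₂ : ℝ} (ht₂ : t₂ ∈ timeInterval T)
    (hu₂ : ℓ < u t₂) : Sweeps ℓ T u v := by
  obtain ⟨t₁, ht₁, -, -, hut₁, hE, hv⟩ := h.exists_crossing hγ hu₁ hℓ hu₀ ht₂ hu₂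
  intro x hx hxℓ
  obtain ⟨s, hs, hus⟩ := intermediate_value_Icc ht₁.1 (h.continuousOn_fst le_rfl ht₁)
    ⟨hx, by rw [hut₁]; exact hxℓ.le⟩
  exact ⟨s, mem_timeInterval_of_le ht₁ hs.1 hs.2, hus,
    hE.le.trans (h.energy_le hγ hs.1 hs.2 ht₁), fun r hr => hv r ⟨hr.1, hr.2.trans hs.2⟩⟩

lemma IsSolutionOn.sweeps_of_converges (h : IsSolutionOn γ u₀ u₁ T u v) {ℓ : ℝ}
    (hconv : ConvergesExponentially T u v (ℓ, 0))
    (hE : ∀ t ∈ timeInterval T, 1 / 4 ≤ energy (u t, v t)) (hv : ∀ t ∈ timeInterval T, 0 < v t) :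
    Sweeps ℓ T u v := by
  have hlim := hconv.tendsto.fst_nhds
  obtain ⟨rfl, -⟩ := hconv
  intro x hx hxℓ
  obtain ⟨t₂, h2, h3⟩ := ((hlim.eventually_const_lt hxℓ).and (eventually_ge_atTop 0)).exists
  have ht₂ := mem_timeInterval_top.2 h3
  obtain ⟨s, hs, hus⟩ := intermediate_value_Icc h3 (h.continuousOn_fst le_rfl ht₂)
    ⟨hx, h2.le⟩
  exact ⟨s, mem_timeInterval_top.2 hs.1, hus, hE s (mem_timeInterval_top.2 hs.1),
    fun r hr => hv r (mem_timeInterval_top.2 hr.1)⟩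

/-- A trajectory which starts to the left of `-1`, does not get to the right of `-1` and does not
enter `𝒦⁻`, converges to `(-1, 0)`. -/
theorem IsMaximalSolution.converges_neg_one (h : IsMaximalSolution γ u₀ u₁ T u v) (hγ : 0 ≤ γ)
    (hu₁ : 0 < u₁) (hu₀ : u₀ < -1) (hle : ∀ t ∈ timeInterval T, u t ≤ -1)
    (hE : ∀ t ∈ timeInterval T, u t < -1 → 1 / 4 ≤ energy (u t, v t)) :
    ConvergesExponentially T u v (-1, 0) ∧ Sweeps (-1) T u v ∧
      ∀ t ∈ timeInterval T, 0 < v t ∧ u t < -1 := by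
  have hsol := h.isSolutionOn
  have hlt := hsol.lt_of_forall_le hu₁ (by norm_num) hu₀ hle
  have hE' : ∀ t ∈ timeInterval T, 1 / 4 ≤ energy (u t, v t) := fun t ht => hE t ht (hlt t ht)
  have hv : ∀ t ∈ timeInterval T, 0 < v t := fun t ht => by
    refine pos_of_no_first_zero (hsol.continuousOn_snd le_rfl ht) (by rwa [hsol.init_deriv])
      (fun s hs _ h0 => ?_) t ⟨ht.1, le_rfl⟩
    have hsT := mem_timeInterval_of_le ht hs.1.le hs.2
    have h1 := hE' s hsT
    have h2 := hlt s hsT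
    rw [energy_eq, h0] at h1
    have h3 : 0 < u s ^ 2 - 1 := by nlinarith
    nlinarith
  have hconv : ConvergesExponentially T u v (-1, 0) := by
    refine h.convergesExponentially_of_le hγ (κ := -2) (c := 1) one_pos (by norm_num)
      (fun x _ hx => ?_) hsol.zero_mem (fun t ht _ => hlt t ht) (fun t ht _ => hv t ht)
      fun t ht _ => ?_
    · nlinarith [mul_pos (by linarith : 0 < -x) (by nlinarith : 0 < x ^ 2 - 1)]
    -- Here (u²−1)/2 = (−1−u)(1−u)/2 and 1 − u > 2, whence the rate 1.
    · have h1 := half_le_of_energy (hE' t ht) (hv t ht).le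
      have h2 := neg_abs_le (1 - u t ^ 2)
      nlinarith [hlt t ht]
  exact ⟨hconv, hsol.sweeps_of_converges hconv hE' hv, fun t ht => ⟨hv t ht, hlt t ht⟩⟩

/-- A trajectory which passes through `[-1, 1)` with positive velocity, does not get to the right of
`1` and does not enter `𝒦⁺`, converges to `(1, 0)`. -/
theorem IsMaximalSolution.converges_one (h : IsMaximalSolution γ u₀ u₁ T u v) (hγ : 0 ≤ γ)
    (hu₁ : 0 < u₁) (hu₀ : u₀ < 1) {t₁ : ℝ} (ht₁ : t₁ ∈ timeInterval T) (hut₁ : -1 ≤ u t₁)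
    (hvt₁ : ∀ r ∈ Icc 0 t₁, 0 < v r) (hle : ∀ t ∈ timeInterval T, u t ≤ 1)
    (hE : ∀ t ∈ timeInterval T, u t ^ 2 < 1 → 1 / 4 ≤ energy (u t, v t)) :
    ConvergesExponentially T u v (1, 0) ∧ Sweeps 1 T u v := by
  have hsol := h.isSolutionOn
  have hlt := hsol.lt_of_forall_le hu₁ (by norm_num) hu₀ hle
  have hv₁ : 0 < v t₁ := hvt₁ t₁ ⟨ht₁.1, le_rfl⟩
  have hvpos : ∀ t ∈ timeInterval T, t₁ ≤ t → 0 < v t := fun t ht h1 => by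
    refine pos_of_no_first_zero (hsol.continuousOn_snd ht₁.1 ht) hv₁
      (fun s hs hpos h0 => ?_) t ⟨h1, le_rfl⟩
    have hsT := mem_timeInterval_of_le ht (ht₁.1.trans hs.1.le) hs.2
    have h2 := hsol.lt_of_snd_pos ht₁.1 hs.1 hsT fun r hr => hpos r ⟨hr.1.le, hr.2⟩
    have h3 : u s ^ 2 < 1 := by nlinarith [hlt s hsT]
    have h4 := hE s hsT h3
    rw [energy_eq, h0] at h4
    nlinarith
  have hv : ∀ t ∈ timeInterval T, 0 < v t := fun t ht => by
    rcases le_total t₁ t with h1 | h1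
    · exact hvpos t ht h1
    · exact hvt₁ t ⟨ht.1, h1⟩
  have hmono : ∀ {s t}, 0 ≤ s → s < t → t ∈ timeInterval T → u s < u t := fun hs hst ht =>
    hsol.lt_of_snd_pos hs hst ht fun r hr =>
      hv r (mem_timeInterval_of_le ht (hs.trans hr.1.le) hr.2.le)
  have hsq : ∀ t ∈ timeInterval T, t₁ < t → u t ^ 2 < 1 := fun t ht h1 => by
    have := hmono ht₁.1 h1 ht
    nlinarith [hlt t ht]
  have hE' : ∀ t ∈ timeInterval T, 1 / 4 ≤ energy (u t, v t) := fun t ht => by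
    rcases lt_or_ge t₁ t with h1 | h1
    · exact hE t ht (hsq t ht h1)
    · obtain ⟨b, hb1, hb⟩ := exists_gt_mem_timeInterval ht₁
      exact (hE b hb (hsq b hb hb1)).trans (hsol.energy_le hγ ht.1 (h1.trans hb1.le) hb)
  -- Since (1−u²)/2 = (1−u)(1+u)/2, the rate is (1+u)/2, which may vanish at t₁; at t₂ it is
  -- positive.
  obtain ⟨t₂, ht₁₂, ht₂⟩ := exists_gt_mem_timeInterval ht₁
  have hut₂ := hmono ht₁.1 ht₁₂ ht₂
  have hconv : ConvergesExponentially T u v (1, 0) := by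
    refine h.convergesExponentially_of_le hγ (κ := 0) (c := (1 + u t₂) / 2) (by linarith)
      one_pos (fun x hx hx1 => ?_) ht₂ (fun t ht _ => hlt t ht) (fun t ht _ => hv t ht)
      fun t ht h2 => ?_
    · nlinarith [mul_nonneg hx (by nlinarith : 0 ≤ 1 - x ^ 2)]
    · have h1 := half_le_of_energy (hE' t ht) (hv t ht).le
      have h3 := le_abs_self (1 - u t ^ 2)
      have h4 : u t₂ ≤ u t := by
        rcases h2.eq_or_lt with rfl | h2
        · exact le_rfl
        · exact (hmono ht₂.1 h2 ht).le
      nlinarith [hlt t ht, mul_nonneg (sub_nonneg.2 h4) (sub_nonneg.2 (hlt t ht).le)]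
  exact ⟨hconv, hsol.sweeps_of_converges hconv hE' hv⟩

end Solution

/-! ### Phase curves and comparison of dampings -/

/-- A function which is continuously differentiable on `[0, s]` extends to a `C¹` function on the
line whose derivative is constant outside of `[0, s]`. -/
lemma exists_hasDerivAt_extension {f f' : ℝ → ℝ} {s : ℝ} (hs : 0 ≤ s)
    (hf : ∀ t ∈ Icc 0 s, HasDerivWithinAt f (f' t) (Ici 0) t) (hf' : ContinuousOn f' (Icc 0 s)) :
    ∃ F : ℝ → ℝ, (∀ t, HasDerivAt F (f' (projIcc 0 s hs t)) t) ∧ EqOn F f (Icc 0 s) := by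
  have hG : Continuous fun t => f' (projIcc 0 s hs t) :=
    (continuousOn_iff_continuous_domRestrict.1 hf').comp continuous_projIcc
  have hF : ∀ t, HasDerivAt (fun t => f 0 + ∫ r in (0 : ℝ)..t, f' (projIcc 0 s hs r))
      (f' (projIcc 0 s hs t)) t := fun t =>
    (intervalIntegral.integral_hasDerivAt_right (hG.intervalIntegrable _ _)
      (hG.stronglyMeasurableAtFilter _ _) hG.continuousAt).const_add _
  refine ⟨_, hF, fun t ht => ?_⟩
  have hd : ∀ r ∈ Icc 0 t, HasDerivWithinAt
      (fun t => (f 0 + ∫ r in (0 : ℝ)..t, f' (projIcc 0 s hs r)) - f t) 0 (Ici 0) r := fun r hr => by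
    have hr' : r ∈ Icc 0 s := ⟨hr.1, hr.2.trans ht.2⟩
    refine ((hF r).hasDerivWithinAt.fun_sub (hf r hr')).congr_deriv ?_
    rw [projIcc_of_mem hs hr', sub_self]
  have h1 := le_of_deriv_nonpos le_rfl ht.1 hd fun _ _ => le_rfl
  have h2 := add_mul_le_of_le_deriv (m := 0) le_rfl ht.1 hd fun _ _ => le_rfl
  simp only [intervalIntegral.integral_same] at h1 h2
  linarith

section Comparison

variable {γ γ' u₀ u₁ : ℝ} {T T' : EReal} {u v u' v' : ℝ → ℝ}

/-- As long as the velocity is positive, the velocity is a differentiable function of the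
position. -/
theorem IsSolutionOn.exists_phase_curve (h : IsSolutionOn γ u₀ u₁ T u v) {s : ℝ}
    (hs : s ∈ timeInterval T) (hv : ∀ r ∈ Icc 0 s, 0 < v r) :
    ∃ w : ℝ → ℝ, Continuous w ∧ ∀ r ∈ Icc 0 s, w (u r) = v r ∧
      HasDerivAt w ((u r ^ 3 - u r - γ * v r) / v r) (u r) := by
  have hcu := h.continuousOn_fst le_rfl hs
  have hcv := h.continuousOn_snd le_rfl hs
  -- Extension to the line makes U a bijection with derivative bounded below by min v > 0, so its
  -- inverse has two-sided derivatives even at the end positions.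
  obtain ⟨U, hU, hUu⟩ := exists_hasDerivAt_extension hs.1 (h.hasDeriv_of_mem le_rfl hs) hcv
  obtain ⟨V, hV, hVv⟩ := exists_hasDerivAt_extension hs.1 (h.hasDeriv_deriv_of_mem le_rfl hs)
    (((hcu.pow 3).sub hcu).sub (hcv.const_mul γ))
  obtain ⟨r₀, hr₀, hmin⟩ := isCompact_Icc.exists_isMinOn ⟨0, le_rfl, hs.1⟩ hcv
  have hm := hv r₀ hr₀
  have hlow : ∀ t, v r₀ ≤ v (projIcc 0 s hs.1 t) := fun t => hmin (projIcc 0 s hs.1 t).2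
  have hmono : StrictMono U := strictMono_of_deriv_pos fun t => by
    rw [(hU t).deriv]
    exact hm.trans_le (hlow t)
  have hUc : Continuous U := continuous_iff_continuousAt.2 fun t => (hU t).continuousAt
  have hVc : Continuous V := continuous_iff_continuousAt.2 fun t => (hV t).continuousAt
  have hlin : Monotone fun t => U t - v r₀ * t := by
    have hd : ∀ t, HasDerivAt (fun t => U t - v r₀ * t) (v (projIcc 0 s hs.1 t) - v r₀) t :=
      fun t => by simpa using (hU t).fun_sub ((hasDerivAt_id t).const_mul (v r₀))
    refine monotone_of_deriv_nonneg (fun t => (hd t).differentiableAt) fun t => ?_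
    rw [(hd t).deriv]
    exact sub_nonneg.2 (hlow t)
  have hsurj : Function.Surjective U := by
    refine hUc.surjective ?_ ?_
    · refine tendsto_atTop_mono' _ ?_ (tendsto_atTop_add_const_left _ (U 0)
        (tendsto_id.const_mul_atTop hm))
      filter_upwards [eventually_ge_atTop 0] with t ht
      have := hlin ht
      simp only [id] at this ⊢
      linarith
    · refine tendsto_atBot_mono' _ ?_ (tendsto_atBot_add_const_left _ (U 0)
        (tendsto_id.const_mul_atBot hm))
      filter_upwards [eventually_le_atBot 0] with t ht
      have := hlin ht
      simp only [id] at this ⊢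
      linarith
  let e := hmono.orderIsoOfSurjective U hsurj
  have he : ∀ t, e.symm (U t) = t := fun t => e.symm_apply_apply t
  have hec : Continuous e.symm := e.symm.continuous
  refine ⟨fun x => V (e.symm x), hVc.comp hec, fun r hr => ?_⟩
  have hur : e.symm (u r) = r := by rw [← hUu hr, he]
  refine ⟨by simp only [hur, hVv hr], ?_⟩
  have hUr : HasDerivAt U (v r) (e.symm (u r)) := by
    rw [hur]
    simpa only [projIcc_of_mem hs.1 hr] using hU r
  have hVr : HasDerivAt V (u r ^ 3 - u r - γ * v r) (e.symm (u r)) := by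
    rw [hur]
    simpa only [projIcc_of_mem hs.1 hr] using hV r
  have hinv : HasDerivAt e.symm (v r)⁻¹ (u r) :=
    hUr.of_local_left_inverse hec.continuousAt (hv r hr).ne'
      (Eventually.of_forall fun x => e.apply_symm_apply x)
  exact hVr.comp (u r) hinv

/-- Comparison of two trajectories with dampings `γ < γ'`: at the same position, the one with the
smaller damping is faster. Moreover, where `x³ - x ≤ 0`, the difference of the velocities grows. -/
theorem IsSolutionOn.comparison (h : IsSolutionOn γ u₀ u₁ T u v)
    (h' : IsSolutionOn γ' u₀ u₁ T' u' v') (hγ : γ < γ') (hu₁ : 0 < u₁) {s b : ℝ}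
    (hs : s ∈ timeInterval T') (hv' : ∀ r ∈ Icc 0 s, 0 < v' r) (hb : b ∈ timeInterval T)
    (hle : ∀ r ∈ Icc 0 b, u r ≤ u' s) :
    (∀ t ∈ Ioc 0 b, ∃ r ∈ Icc 0 s, u' r = u t ∧ v' r < v t) ∧
      ∀ a ∈ Ioc 0 b, (∀ t ∈ Icc a b, u t ^ 3 - u t ≤ 0) → ∀ ra ∈ Icc 0 s, ∀ rb ∈ Icc 0 s,
        u' ra = u a → u' rb = u b → v a - v' ra ≤ v b - v' rb := by
  obtain ⟨w, hw, hwr⟩ := h'.exists_phase_curve hs hv'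
  -- This is the velocity gap at equal positions. Wherever it vanishes with v > 0, its derivative is
  -- (γ' − γ)v > 0.
  set g : ℝ → ℝ := fun t => v t - w (u t) with hg
  have hmem : ∀ {t}, t ∈ Icc 0 b → t ∈ timeInterval T := fun ht =>
    mem_timeInterval_of_le hb ht.1 ht.2
  have hgd : ∀ t ∈ Icc 0 b, ∀ r ∈ Icc 0 s, u' r = u t → HasDerivWithinAt g
      (u t ^ 3 - u t - γ * v t - (u t ^ 3 - u t - γ' * v' r) / v' r * v t) (Ici 0) t := by
    intro t ht r hr hur
    have h1 := (hwr r hr).2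
    rw [hur] at h1
    exact (h.hasDeriv_deriv t (hmem ht)).fun_sub
      (h1.comp_hasDerivWithinAt t (h.hasDeriv t (hmem ht)))
  have hgc : ContinuousOn g (Icc 0 b) :=
    (h.continuousOn_snd le_rfl hb).sub (hw.comp_continuousOn (h.continuousOn_fst le_rfl hb))
  have hinit : u' 0 = u 0 ∧ v' 0 = v 0 := by
    rw [h.init, h'.init, h.init_deriv, h'.init_deriv]
    exact ⟨rfl, rfl⟩
  have hs0 : (0 : ℝ) ∈ Icc 0 s := ⟨le_rfl, hs.1⟩
  have hb0 : (0 : ℝ) ∈ Icc 0 b := ⟨le_rfl, hb.1⟩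
  have hv0 : 0 < v 0 := by rwa [h.init_deriv]
  have hg0 : g 0 = 0 := by
    simp only [hg]
    rw [← hinit.1, (hwr 0 hs0).1, hinit.2, sub_self]
  -- Both trajectories start from the same data, so g(0) = 0 and positivity must come from the
  -- derivative.
  have hstart : ∀ᶠ t in 𝓝[>] (0 : ℝ), 0 < min (g t) (v t) := by
    have h1 := hgd 0 hb0 0 hs0 hinit.1
    have h2 : u 0 ^ 3 - u 0 - γ * v 0 - (u 0 ^ 3 - u 0 - γ' * v' 0) / v' 0 * v 0 =
        (γ' - γ) * v 0 := by
      rw [hinit.2]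
      field_simp
      ring
    rw [h2] at h1
    have h3 : Tendsto (slope g 0) (𝓝[>] 0) (𝓝 ((γ' - γ) * v 0)) :=
      (hasDerivWithinAt_iff_tendsto_slope' self_notMem_Ioi).1 (h1.mono Ioi_subset_Ici_self)
    have h4 : ContinuousWithinAt v (Ioi 0) 0 :=
      (h.hasDeriv_deriv 0 (hmem hb0)).continuousWithinAt.mono Ioi_subset_Ici_self
    filter_upwards [h3.eventually_const_lt (mul_pos (sub_pos.2 hγ) hv0),
      h4.tendsto.eventually_const_lt hv0, self_mem_nhdsWithin] with t ht1 ht2 ht3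
    refine lt_min ?_ ht2
    rw [slope_def_field, hg0, sub_zero, sub_zero] at ht1
    exact (div_pos_iff_of_pos_right ht3).1 ht1
  have hpre : ∀ t ∈ Icc 0 b, (∀ r ∈ Ioo 0 t, 0 < v r) → ∃ r ∈ Icc 0 s, u' r = u t := by
    intro t ht hpos
    have h1 := h.le_of_snd_pos le_rfl ht.1 (hmem ht) hpos
    exact intermediate_value_Icc hs.1 (h'.continuousOn_fst le_rfl hs)
      ⟨hinit.1.trans_le h1, hle t ht⟩
  -- The minimum treats both signs at once: v > 0 keeps u within the positions where w is the phase
  -- curve, and there g ≥ 0 in turn forces v ≥ v' > 0.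
  have hpos : ∀ t ∈ Ioc 0 b, 0 < min (g t) (v t) := by
    intro t ht
    obtain ⟨a, ha, hasub⟩ := mem_nhdsGT_iff_exists_Ioc_subset.1 hstart
    have ha : 0 < a := ha
    rcases le_or_gt t a with hta | hta
    · exact hasub ⟨ht.1, hta⟩
    refine pos_of_no_first_zero (g := fun t => min (g t) (v t)) (a := a) (b := b)
      ((continuous_min.comp_continuousOn (hgc.prodMk (h.continuousOn_snd le_rfl hb))).mono (Icc_subset_Icc_left ha.le))
      (hasub ⟨ha, le_rfl⟩) (fun p hp hbefore hp0 => ?_) t ⟨hta.le, ht.2⟩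
    have hall : ∀ q ∈ Ioo 0 p, 0 < min (g q) (v q) := fun q hq => by
      rcases le_or_gt q a with hqa | hqa
      · exact hasub ⟨hq.1, hqa⟩
      · exact hbefore q ⟨hqa.le, hq.2⟩
    have hp0' : 0 < p := ha.trans hp.1
    have hpb : p ∈ Icc 0 b := ⟨hp0'.le, hp.2⟩
    obtain ⟨r, hr, hur⟩ := hpre p hpb fun q hq => (lt_min_iff.1 (hall q hq)).2
    have hwp : w (u p) = v' r := by rw [← hur, (hwr r hr).1]
    have hr0 := hv' r hr
    have hgp : g p = v p - v' r := by simp only [hg, hwp]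
    have hg1 : 0 ≤ g p := hp0 ▸ min_le_left _ _
    have hv1 : 0 < v p := by linarith
    have hgp0 : g p = 0 := by
      rcases min_choice (g p) (v p) with h1 | h1
      · rw [← h1, hp0]
      · rw [h1] at hp0
        exact absurd hp0 hv1.ne'
    have h1 := deriv_nonpos_of_pos_left hp0' ((hgd p hpb r hr hur).hasDerivAt (Ici_mem_nhds hp0'))
      hgp0 fun q hq => (lt_min_iff.1 (hall q hq)).1
    have h2 : v p = v' r := by linarith
    have h3 : u p ^ 3 - u p - γ * v p - (u p ^ 3 - u p - γ' * v' r) / v' r * v p =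
        (γ' - γ) * v p := by
      rw [h2]
      field_simp
      ring
    rw [h3] at h1
    exact absurd h1 (not_le.2 (mul_pos (sub_pos.2 hγ) hv1))
  have hex : ∀ t ∈ Ioc 0 b, ∃ r ∈ Icc 0 s, u' r = u t ∧ v' r < v t := by
    intro t ht
    obtain ⟨r, hr, hur⟩ := hpre t ⟨ht.1.le, ht.2⟩ fun q hq =>
      (lt_min_iff.1 (hpos q ⟨hq.1, hq.2.le.trans ht.2⟩)).2
    refine ⟨r, hr, hur, ?_⟩
    have h1 := (lt_min_iff.1 (hpos t ht)).1
    simp only [hg] at h1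
    rw [← hur, (hwr r hr).1] at h1
    linarith
  refine ⟨hex, fun a ha hneg ra hra rb hrb hura hurb => ?_⟩
  have hgv : ∀ t, ∀ r ∈ Icc 0 s, u' r = u t → g t = v t - v' r := fun t r hr hur => by
    simp only [hg]
    rw [← hur, (hwr r hr).1]
  rw [← hgv a ra hra hura, ← hgv b rb hrb hurb]
  choose! ρ hρ hρu hρv using hex
  have hab : ∀ {t}, t ∈ Icc a b → t ∈ Ioc 0 b := fun ht => ⟨ha.1.trans_le ht.1, ht.2⟩
  refine monotoneOn_Icc_of_deriv_nonneg ha.1.le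
    (fun t ht => hgd t ⟨(hab ht).1.le, ht.2⟩ (ρ t) (hρ t (hab ht)) (hρu t (hab ht)))
    (fun t ht => ?_) ⟨le_rfl, ha.2⟩ ⟨ha.2, le_rfl⟩ ha.2
  have ht' : t ∈ Icc a b := ⟨ht.1.le, ht.2.le⟩
  have h1 := hneg t ht'
  have h2 := hρv t (hab ht')
  have h3 := hv' _ (hρ t (hab ht'))
  -- The first term of this form of g' is nonnegative exactly because u³ − u ≤ 0.
  have h4 : u t ^ 3 - u t - γ * v t - (u t ^ 3 - u t - γ' * v' (ρ t)) / v' (ρ t) * v t =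
      (-(u t ^ 3 - u t)) * (v t - v' (ρ t)) / v' (ρ t) + (γ' - γ) * v t := by
    field_simp
    ring
  rw [h4]
  have h5 : 0 ≤ v t - v' (ρ t) := by linarith
  have h6 : 0 ≤ -(u t ^ 3 - u t) := by linarith
  have h7 : 0 ≤ γ' - γ := by linarith
  have h8 : 0 < v t := h3.trans h2
  positivity

/-- If a trajectory sweeps `[u₀, ℓ)`, then the trajectory with smaller damping crosses `ℓ`. -/
theorem IsMaximalSolution.exists_lt_of_sweeps (h : IsMaximalSolution γ u₀ u₁ T u v)
    (h' : IsSolutionOn γ' u₀ u₁ T' u' v') (hγ0 : 0 ≤ γ) (hγ : γ < γ') (hu₁ : 0 < u₁) {ℓ κ : ℝ}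
    (hℓ : ℓ ^ 2 = 1) (hu₀ : u₀ ≤ κ) (hκ : κ < ℓ) (hneg : ∀ x, κ ≤ x → x < ℓ → x ^ 3 - x ≤ 0)
    (hsw : Sweeps ℓ T' u' v') : ∃ t ∈ timeInterval T, ℓ < u t := by
  by_contra! hle
  have hsol := h.isSolutionOn
  have hlt := hsol.lt_of_forall_le hu₁ hℓ (hu₀.trans_lt hκ) hle
  have hv : ∀ t ∈ timeInterval T, 0 < v t := by
    intro t ht
    rcases ht.1.eq_or_lt with rfl | h0
    · rwa [hsol.init_deriv]
    -- Sweeping up to the maximal position on [0, t] provides a comparison range that contains the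
    -- whole piece of trajectory.
    obtain ⟨m, hm, hmax⟩ := isCompact_Icc.exists_isMaxOn ⟨0, le_rfl, ht.1⟩
      (hsol.continuousOn_fst le_rfl ht)
    obtain ⟨s, hs, hus, -, hvs⟩ := hsw (u m)
      (by rw [h'.init, ← hsol.init]; exact hmax ⟨le_rfl, ht.1⟩)
      (hlt m (mem_timeInterval_of_le ht hm.1 hm.2))
    obtain ⟨r, hr, -, hrt⟩ := (hsol.comparison h' hγ hu₁ hs hvs ht
      (fun r hr => hus ▸ hmax hr)).1 t ⟨h0, le_rfl⟩
    exact (hvs r hr).trans hrt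
  have hmono : ∀ {s t}, 0 ≤ s → s ≤ t → t ∈ timeInterval T → u s ≤ u t := fun hs hst ht =>
    hsol.le_of_snd_pos hs hst ht fun r hr =>
      hv r (mem_timeInterval_of_le ht (hs.trans hr.1.le) hr.2.le)
  obtain rfl : T = ⊤ := h.eq_top_of_fst_bounded hγ0 (R := max |u 0| |ℓ|) fun t ht =>
    abs_le_max_abs_abs (hmono le_rfl ht.1 ht) (hle t ht)
  have mem : ∀ {t : ℝ}, 0 ≤ t → t ∈ timeInterval ⊤ := fun ht => mem_timeInterval_top.2 ht
  have hbdd : ∀ a d : ℝ, 0 ≤ a → 0 < d → ¬ ∀ t, a < t → d ≤ v t := by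
    intro a d ha hd hcon
    have h1 : 0 ≤ (ℓ - u a) / d := div_nonneg (by linarith [hle a (mem ha)]) hd.le
    have h2 := add_mul_le_of_le_deriv (m := d) (f := u) (f' := v) ha
      (b := a + (ℓ - u a) / d) (by linarith)
      (hsol.hasDeriv_of_mem ha (mem (by linarith))) (fun t ht => hcon t ht.1)
    have h3 : d * (a + (ℓ - u a) / d - a) = ℓ - u a := by field_simp; ring
    have h4 := hlt (a + (ℓ - u a) / d) (mem (by linarith))
    linarith
  -- If u stayed below κ, comparison on the range up to κ would bound v below by the positive
  -- minimum of v' there.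
  obtain ⟨a, ha, hκa⟩ : ∃ a, 0 < a ∧ κ ≤ u a := by
    by_contra! hcon
    obtain ⟨s, hs, hus, -, hvs⟩ := hsw κ (by rwa [h'.init]) hκ
    obtain ⟨r₀, hr₀, hmin⟩ := isCompact_Icc.exists_isMinOn ⟨0, le_rfl, hs.1⟩
      (h'.continuousOn_snd le_rfl hs)
    refine hbdd 0 (v' r₀) le_rfl (hvs r₀ hr₀) fun t ht => ?_
    obtain ⟨r, hr, -, hrt⟩ := (hsol.comparison h' hγ hu₁ hs hvs (mem ht.le) (fun r hr => by
      rw [hus]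
      exact (hmono hr.1 hr.2 (mem ht.le)).trans (hcon t ht).le)).1 t ⟨ht, le_rfl⟩
    exact (hmin hr).trans hrt.le
  obtain ⟨s₀, hs₀, hus₀, -, hvs₀⟩ := hsw (u a)
    (by rw [h'.init, ← hsol.init]; exact hmono le_rfl ha.le (mem ha.le)) (hlt a (mem ha.le))
  have hd : 0 < v a - v' s₀ := by
    obtain ⟨r, hr, hur, hrt⟩ := (hsol.comparison h' hγ hu₁ hs₀ hvs₀ (mem ha.le)
      (fun r hr => hus₀ ▸ hmono hr.1 hr.2 (mem ha.le))).1 a ⟨ha, le_rfl⟩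
    obtain rfl : r = s₀ := by
      by_contra hne
      have := h'.lt_of_snd_pos hr.1 (lt_of_le_of_ne hr.2 hne) hs₀ fun q hq =>
        hvs₀ q ⟨hr.1.trans hq.1.le, hq.2.le⟩
      linarith
    linarith
  -- Past κ the gap at a never shrinks and v' is positive, so v stays above that gap and u would
  -- pass ℓ in finite time.
  refine hbdd a (v a - v' s₀) ha.le hd fun t ht => ?_
  have ht0 : 0 ≤ t := ha.le.trans ht.le
  obtain ⟨s, hs, hus, -, hvs⟩ := hsw (u t)
    (by rw [h'.init, ← hsol.init]; exact hmono le_rfl ht0 (mem ht0)) (hlt t (mem ht0))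
  have hss : s₀ ≤ s := by
    by_contra! hlt'
    have h1 := h'.lt_of_snd_pos hs.1 hlt' hs₀ fun q hq => hvs₀ q ⟨hs.1.trans hq.1.le, hq.2.le⟩
    have h2 := hmono ha.le ht.le (mem ht0)
    linarith
  have h1 := (hsol.comparison h' hγ hu₁ hs hvs (mem ht0)
    (fun r hr => hus ▸ hmono hr.1 hr.2 (mem ht0))).2 a ⟨ha, ht.le⟩
    (fun r hr => hneg _ (hκa.trans (hmono ha.le hr.1 (mem (ha.le.trans hr.1))))
      (hlt r (mem (ha.le.trans hr.1)))) s₀ ⟨hs₀.1, hss⟩ s ⟨hs.1, le_rfl⟩ hus₀ hus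
  linarith [hvs s ⟨hs.1, le_rfl⟩]

end Comparison

/-! ### The abstract threshold argument -/

section Threshold

lemma exists_lt_of_isOpen {P : ℝ → Prop} (hP : IsOpen {γ | P γ}) {a γ : ℝ} (hγ : P γ)
    (ha : a < γ) : ∃ γ', a < γ' ∧ γ' < γ ∧ P γ' := by
  have h1 : ∀ᶠ x in 𝓝[<] γ, P x := nhdsWithin_le_nhds (hP.mem_nhds hγ)
  obtain ⟨x, hx, hx'⟩ := (h1.and (Ioo_mem_nhdsLT ha)).exists
  exact ⟨x, hx'.1, hx'.2, hx⟩

lemma exists_gt_of_isOpen {P : ℝ → Prop} (hP : IsOpen {γ | P γ}) {γ : ℝ} (hγ : P γ) :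
    ∃ γ', γ < γ' ∧ P γ' := by
  have h1 : ∀ᶠ x in 𝓝[>] γ, P x := nhdsWithin_le_nhds (hP.mem_nhds hγ)
  obtain ⟨x, hx, hx'⟩ := (h1.and self_mem_nhdsWithin).exists
  exact ⟨x, hx', hx⟩

/-- Two mutually exclusive alternatives, one for small and one for large parameters, are separated
by a single parameter. -/
theorem exists_threshold {P Q : ℝ → Prop} (h0 : ¬ Q 0) (hbdd : ∃ M, ∀ γ, 0 ≤ γ → ¬ Q γ → γ ≤ M)
    (hmono : ∀ γ γ', 0 ≤ γ → γ < γ' → ¬ Q γ' → P γ) (hexcl : ∀ γ, 0 ≤ γ → P γ → ¬ Q γ)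
    (hP : ∀ γ, P γ → ∃ γ', γ < γ' ∧ P γ') (hQ : ∀ γ, 0 < γ → Q γ → ∃ γ', 0 < γ' ∧ γ' < γ ∧ Q γ') :
    ∃ γ₀, 0 ≤ γ₀ ∧ (∀ γ, 0 ≤ γ → γ < γ₀ → P γ) ∧ ¬ P γ₀ ∧ ¬ Q γ₀ ∧ ∀ γ, γ₀ < γ → Q γ := by
  -- The threshold is the supremum of the parameters where Q fails. If P held there it would persist
  -- to the right, where Q holds; if Q held there it would persist to the left, where P holds.
  set A : Set ℝ := {γ | 0 ≤ γ ∧ ¬ Q γ} with hA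
  obtain ⟨M, hM⟩ := hbdd
  have hAb : BddAbove A := ⟨M, fun γ hγ => hM γ hγ.1 hγ.2⟩
  have h0A : (0 : ℝ) ∈ A := ⟨le_rfl, h0⟩
  have hγ₀ : 0 ≤ sSup A := le_csSup hAb h0A
  have hlow : ∀ γ, 0 ≤ γ → γ < sSup A → P γ := fun γ h1 h2 => by
    obtain ⟨γ', h3, h4⟩ := exists_lt_of_lt_csSup ⟨0, h0A⟩ h2
    exact hmono γ γ' h1 h4 h3.2
  have hup : ∀ γ, sSup A < γ → Q γ := fun γ h1 => by
    by_contra h2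
    exact absurd (le_csSup hAb ⟨hγ₀.trans h1.le, h2⟩) (not_le.2 h1)
  refine ⟨sSup A, hγ₀, hlow, fun h1 => ?_, fun h1 => ?_, hup⟩
  · obtain ⟨γ', h2, h3⟩ := hP _ h1
    exact hexcl γ' (hγ₀.trans h2.le) h3 (hup γ' h2)
  · rcases hγ₀.eq_or_lt with h2 | h2
    · rw [← h2] at h1
      exact h0 h1
    · obtain ⟨γ', h3, h4, h5⟩ := hQ _ h2 h1
      exact hexcl γ' h3.le (hlow γ' h3.le h4) h5

end Threshold

/-! ### The alternatives at each saddle -/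

/-- The open half plane to the right of `ℓ`. -/
def rightOf (ℓ : ℝ) : Set (ℝ × ℝ) := {p | ℓ < p.1}

/-- The set `𝒦⁺` of data of energy less than `1/4` between the saddles. -/
def setKPlus : Set (ℝ × ℝ) := {p | energy p < 1 / 4 ∧ p.1 ^ 2 < 1}

/-- The left component of `𝒦⁻`. -/
def setKLeft : Set (ℝ × ℝ) := {p | energy p < 1 / 4 ∧ p.1 < -1}

lemma isOpen_rightOf (ℓ : ℝ) : IsOpen (rightOf ℓ) := isOpen_lt continuous_const continuous_fst

lemma isOpen_setKPlus : IsOpen setKPlus :=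
  (isOpen_lt continuous_energy continuous_const).inter
    (isOpen_lt (continuous_fst.pow 2) continuous_const)

/-- The level is left free because levels slightly above 1/4 are needed when separating the two
thresholds. -/
lemma isOpen_energy_lt_inter (c : ℝ) : IsOpen {p : ℝ × ℝ | energy p < c ∧ p.1 < -1} :=
  (isOpen_lt continuous_energy continuous_const).inter (isOpen_lt continuous_fst continuous_const)

section Alternatives

variable {γ u₀ u₁ : ℝ} {T : EReal} {u v : ℝ → ℝ}

/-- Neither order of events is possible: 𝒦⁺ is forward invariant, and after an upward crossing of 1
the trajectory stays to the right of 1. -/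
lemma IsSolutionOn.not_setKPlus_of_rightOf (h : IsSolutionOn γ u₀ u₁ T u v) (hγ : 0 ≤ γ)
    (hu₁ : 0 < u₁) (hu₀ : u₀ < 1) (hR : Enters T u v (rightOf 1)) : ¬ Enters T u v setKPlus := by
  rintro ⟨s, hs, hE, hus⟩
  obtain ⟨t, ht, hut⟩ := hR
  have hut : 1 < u t := hut
  rcases le_total s t with hst | hst
  · have := h.sq_lt_one_of_energy_lt hγ hs.1 hus hE ht hst
    nlinarith
  · obtain ⟨t₁, ht₁, -, htt, hut₁, -, hv⟩ := h.exists_crossing hγ hu₁ (by norm_num) hu₀ ht hut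
    have := h.one_lt_of_one_le ht₁.1 hut₁.ge (hv t₁ ⟨ht₁.1, le_rfl⟩) hs (htt.trans_le hst)
    simp only at hus
    nlinarith

lemma IsSolutionOn.not_setKLeft_of_rightOf (h : IsSolutionOn γ u₀ u₁ T u v) (hγ : 0 ≤ γ)
    (hu₁ : 0 < u₁) (hu₀ : u₀ < -1) (hR : Enters T u v (rightOf (-1))) :
    ¬ Enters T u v setKLeft := by
  rintro ⟨s, hs, hE, hus⟩
  obtain ⟨t, ht, hut⟩ := hR
  have hut : -1 < u t := hut
  have hus : u s < -1 := hus
  rcases le_total s t with hst | hst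
  · have := h.lt_neg_one_of_energy_lt hγ hs.1 hus hE ht hst
    linarith
  · obtain ⟨t₁, ht₁, -, htt, hut₁, -, hv⟩ := h.exists_crossing hγ hu₁ (by norm_num) hu₀ ht hut
    have := h.neg_one_le hγ hu₁ ht₁.1 hut₁.ge (hv t₁ ⟨ht₁.1, le_rfl⟩) hs (htt.le.trans hst)
    linarith

lemma IsMaximalSolution.enters_setN1 (h : IsMaximalSolution γ u₀ u₁ T u v) (hγ : 0 ≤ γ)
    (hu₁ : 0 < u₁) (hu₀ : u₀ < 1) (hR : Enters T u v (rightOf 1)) :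
    Enters T u v setN1 ∧ BlowsUp T := by
  obtain ⟨t, ht, hut⟩ := hR
  obtain ⟨t₁, ht₁, -, -, hut₁, hE, hv⟩ :=
    h.isSolutionOn.exists_crossing hγ hu₁ (by norm_num) hu₀ ht hut
  have hv₁ := hv t₁ ⟨ht₁.1, le_rfl⟩
  exact ⟨⟨t₁, ht₁, hE.le, hv₁, hut₁.ge⟩, h.blowsUp_of_one_le hγ ht₁ hut₁.ge hv₁⟩

lemma IsMaximalSolution.enters_setKMinus_left (h : IsMaximalSolution γ u₀ u₁ T u v) (hγ : 0 ≤ γ)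
    (hK : Enters T u v setKLeft) :
    Enters T u v (setKMinus ∩ {p | p.1 < -1}) ∧ BlowsUp T := by
  obtain ⟨t, ht, hE, hut⟩ := hK
  have hut' : u t < -1 := hut
  refine ⟨⟨t, ht, ⟨hE, ?_⟩, hut⟩, h.blowsUp_of_lt_neg_one hγ ht hut hE⟩
  exact lt_of_lt_of_le (by simp only; linarith) (neg_le_abs _)

lemma IsMaximalSolution.converges_one_of_not (h : IsMaximalSolution γ u₀ u₁ T u v) (hγ : 0 ≤ γ)
    (hu₁ : 0 < u₁) (hu₀ : u₀ < 1) {t₁ : ℝ} (ht₁ : t₁ ∈ timeInterval T) (hut₁ : -1 ≤ u t₁)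
    (hvt₁ : ∀ r ∈ Icc 0 t₁, 0 < v r) (hR : ¬ Enters T u v (rightOf 1))
    (hK : ¬ Enters T u v setKPlus) :
    ConvergesExponentially T u v (1, 0) ∧ Sweeps 1 T u v :=
  h.converges_one hγ hu₁ hu₀ ht₁ hut₁ hvt₁
    (fun t ht => not_lt.1 fun hlt => hR ⟨t, ht, hlt⟩)
    fun t ht hut => not_lt.1 fun hE => hK ⟨t, ht, hE, hut⟩

lemma IsMaximalSolution.sweeps_one (h : IsMaximalSolution γ u₀ u₁ T u v) (hγ : 0 ≤ γ)
    (hu₁ : 0 < u₁) (hu₀ : u₀ < 1) {t₁ : ℝ} (ht₁ : t₁ ∈ timeInterval T) (hut₁ : -1 ≤ u t₁)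
    (hvt₁ : ∀ r ∈ Icc 0 t₁, 0 < v r) (hK : ¬ Enters T u v setKPlus) : Sweeps 1 T u v := by
  by_cases hR : Enters T u v (rightOf 1)
  · obtain ⟨t, ht, hut⟩ := hR
    exact h.isSolutionOn.sweeps_of_lt hγ hu₁ (by norm_num) hu₀ ht hut
  · exact (h.converges_one_of_not hγ hu₁ hu₀ ht₁ hut₁ hvt₁ hR hK).2

lemma IsMaximalSolution.converges_neg_one_of_not (h : IsMaximalSolution γ u₀ u₁ T u v)
    (hγ : 0 ≤ γ) (hu₁ : 0 < u₁) (hu₀ : u₀ < -1) (hR : ¬ Enters T u v (rightOf (-1)))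
    (hK : ¬ Enters T u v setKLeft) :
    ConvergesExponentially T u v (-1, 0) ∧ Sweeps (-1) T u v ∧
      ∀ t ∈ timeInterval T, 0 < v t ∧ u t < -1 :=
  h.converges_neg_one hγ hu₁ hu₀ (fun t ht => not_lt.1 fun hlt => hR ⟨t, ht, hlt⟩)
    fun t ht hut => not_lt.1 fun hE => hK ⟨t, ht, hE, hut⟩

lemma IsMaximalSolution.sweeps_neg_one (h : IsMaximalSolution γ u₀ u₁ T u v) (hγ : 0 ≤ γ)
    (hu₁ : 0 < u₁) (hu₀ : u₀ < -1) (hK : ¬ Enters T u v setKLeft) : Sweeps (-1) T u v := by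
  by_cases hR : Enters T u v (rightOf (-1))
  · obtain ⟨t, ht, hut⟩ := hR
    exact h.isSolutionOn.sweeps_of_lt hγ hu₁ (by norm_num) hu₀ ht hut
  · exact (h.converges_neg_one_of_not hγ hu₁ hu₀ hR hK).2.1

/-- An upper bound for the damping of a trajectory which passes over a given position. -/
lemma IsSolutionOn.damping_le_of_sweeps (h : IsSolutionOn γ u₀ u₁ T u v) (hγ : 0 ≤ γ) {σ x ℓ : ℝ}
    (hσ : |σ| = 1) (hx : u₀ ≤ x) (hxℓ : x < ℓ)
    (hpos : 0 < σ * (x - x ^ 3 / 3) - σ * (u₀ - u₀ ^ 3 / 3)) (hsw : Sweeps ℓ T u v) :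
    γ ≤ 2 * (energy (u₀, u₁) - 1 / 4) / (σ * (x - x ^ 3 / 3) - σ * (u₀ - u₀ ^ 3 / 3)) := by
  obtain ⟨s, hs, hus, hE, hv⟩ := hsw x (by rwa [h.init]) hxℓ
  have h1 := h.energy_add_le hγ σ hσ le_rfl hs.1 hs hE hv
  rw [h.init, h.init_deriv, hus] at h1
  rw [hus] at hE
  rw [le_div_iff₀ hpos]
  linarith

end Alternatives

/-! ### Existence and order of the critical dampings -/

section Main

variable {u₀ u₁ : ℝ}

/-- Without damping, data of energy at least `1/4` do not enter the region of lower energy. -/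
lemma not_reaches_of_zero {S : Set (ℝ × ℝ)} (hS : ∀ p ∈ S, energy p < 1 / 4)
    (hN : 1 / 4 ≤ energy (u₀, u₁)) : ¬ Reaches u₀ u₁ S 0 := by
  rintro ⟨T, u, v, h, t, ht, htS⟩
  have h1 := hS _ htS
  rw [h.isSolutionOn.energy_eq_init rfl ht] at h1
  linarith

/-- The threshold for the saddle `(1, 0)` for data in `𝒩₂`. -/
theorem exists_threshold_setN2 (hN : 1 / 4 ≤ energy (u₀, u₁)) (hu₁ : 0 < u₁) (hl : -1 ≤ u₀)
    (hr : u₀ < 1) :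
    ∃ γ₀, 0 ≤ γ₀ ∧ (∀ γ, 0 ≤ γ → γ < γ₀ → Reaches u₀ u₁ (rightOf 1) γ) ∧
      ¬ Reaches u₀ u₁ (rightOf 1) γ₀ ∧ ¬ Reaches u₀ u₁ setKPlus γ₀ ∧
      (∀ γ, γ₀ < γ → Reaches u₀ u₁ setKPlus γ) ∧ (energy (u₀, u₁) = 1 / 4 → γ₀ = 0) := by
  have hsweeps : ∀ {γ T u v}, 0 ≤ γ → IsMaximalSolution γ u₀ u₁ T u v →
      ¬ Reaches u₀ u₁ setKPlus γ → Sweeps 1 T u v := fun hγ h hK =>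
    h.sweeps_one hγ hu₁ hr h.isSolutionOn.zero_mem (by rwa [h.isSolutionOn.init])
      (fun r hr => by rwa [le_antisymm hr.2 hr.1, h.isSolutionOn.init_deriv])
      fun hE => hK (h.reaches_iff.2 hE)
  -- Any position strictly between u₀ and 1 would do: u − u³/3 increases up to it, which bounds the
  -- damping.
  set x := (u₀ + 1) / 2 with hx
  have hpos : 0 < 1 * (x - x ^ 3 / 3) - 1 * (u₀ - u₀ ^ 3 / 3) := by
    have h1 : 1 * (x - x ^ 3 / 3) - 1 * (u₀ - u₀ ^ 3 / 3) =
        (x - u₀) * ((1 - x ^ 2) + (1 - u₀ ^ 2) + (1 - x * u₀)) / 3 := by ring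
    have h2 : 0 < x - u₀ := by linarith
    have h3 : 0 < 1 - x ^ 2 := by nlinarith
    have h4 : 0 ≤ 1 - u₀ ^ 2 := by nlinarith
    have h5 : 0 ≤ 1 - x * u₀ := by nlinarith [sq_nonneg (x - u₀)]
    rw [h1]
    positivity
  have hbound : ∀ γ, 0 ≤ γ → ¬ Reaches u₀ u₁ setKPlus γ → γ ≤ 2 * (energy (u₀, u₁) - 1 / 4) /
      (1 * (x - x ^ 3 / 3) - 1 * (u₀ - u₀ ^ 3 / 3)) := fun γ hγ hK => by
    obtain ⟨T, u, v, h⟩ := exists_isMaximalSolution γ u₀ u₁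
    exact h.isSolutionOn.damping_le_of_sweeps hγ (by simp) (by linarith) (by linarith) hpos
      (hsweeps hγ h hK)
  obtain ⟨γ₀, h0, hlow, hP, hQ, hup⟩ := exists_threshold (P := Reaches u₀ u₁ (rightOf 1))
    (Q := Reaches u₀ u₁ setKPlus) (not_reaches_of_zero (fun p hp => hp.1) hN) ⟨_, hbound⟩
    (fun γ γ' hγ hγγ' hK => by
      obtain ⟨T, u, v, h⟩ := exists_isMaximalSolution γ u₀ u₁
      obtain ⟨T', u', v', h'⟩ := exists_isMaximalSolution γ' u₀ u₁
      obtain ⟨t, ht, hut⟩ := h.exists_lt_of_sweeps h'.isSolutionOn hγ hγγ' hu₁ (ℓ := 1)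
        -- The gap grows only where y³ − y ≤ 0, hence the restriction to y ≥ 0.
        (κ := max u₀ 0) (by norm_num) (le_max_left _ _) (max_lt hr one_pos)
        (fun y hy hy1 => by
          have := (le_max_right u₀ 0).trans hy
          nlinarith [mul_nonneg this (by nlinarith : 0 ≤ 1 - y ^ 2)])
        (hsweeps (hγ.trans hγγ'.le) h' hK)
      exact ⟨T, u, v, h, t, ht, hut⟩)
    (fun γ hγ hR => by
      obtain ⟨T, u, v, h, hR⟩ := hR
      rw [h.reaches_iff]
      exact h.isSolutionOn.not_setKPlus_of_rightOf hγ hu₁ hr hR)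
    (fun γ hR => exists_gt_of_isOpen (isOpen_reaches (isOpen_rightOf 1) u₀ u₁) hR)
    (fun γ hγ hK => exists_lt_of_isOpen (isOpen_reaches isOpen_setKPlus u₀ u₁) hK hγ)
  refine ⟨γ₀, h0, hlow, hP, hQ, hup, fun hE => le_antisymm ?_ h0⟩
  -- The bound on γ₀ is proportional to E − 1/4 and vanishes here.
  simpa [hE] using hbound γ₀ h0 hQ

/-- The threshold for the saddle `(-1, 0)` for data in `𝒩₃`. -/
theorem exists_threshold_left (hN : 1 / 4 < energy (u₀, u₁)) (hu₁ : 0 < u₁) (hl : u₀ < -1) :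
    ∃ γ₁, 0 < γ₁ ∧ (∀ γ, 0 ≤ γ → γ < γ₁ → Reaches u₀ u₁ (rightOf (-1)) γ) ∧
      ¬ Reaches u₀ u₁ (rightOf (-1)) γ₁ ∧ ¬ Reaches u₀ u₁ setKLeft γ₁ ∧
      ∀ γ, γ₁ < γ → Reaches u₀ u₁ setKLeft γ := by
  have hsweeps : ∀ {γ T u v}, 0 ≤ γ → IsMaximalSolution γ u₀ u₁ T u v →
      ¬ Reaches u₀ u₁ setKLeft γ → Sweeps (-1) T u v := fun hγ h hK =>
    h.sweeps_neg_one hγ hu₁ hl fun hE => hK (h.reaches_iff.2 hE)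
  -- To the left of −1 the function u − u³/3 decreases, hence σ = −1 in the bound.
  set x := (u₀ - 1) / 2 with hx
  have hpos : 0 < -1 * (x - x ^ 3 / 3) - -1 * (u₀ - u₀ ^ 3 / 3) := by
    have h1 : -1 * (x - x ^ 3 / 3) - -1 * (u₀ - u₀ ^ 3 / 3) =
        (x - u₀) * ((x ^ 2 - 1) + (u₀ ^ 2 - 1) + (x * u₀ - 1)) / 3 := by ring
    have h2 : 0 < x - u₀ := by linarith
    have h3 : 0 < x ^ 2 - 1 := by nlinarith
    have h4 : 0 < u₀ ^ 2 - 1 := by nlinarith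
    have h5 : 0 < x * u₀ - 1 := by nlinarith
    rw [h1]
    positivity
  have h00 := not_reaches_of_zero (S := setKLeft) (fun p hp => hp.1) hN.le
  obtain ⟨γ₁, h0, hlow, hP, hQ, hup⟩ := exists_threshold (P := Reaches u₀ u₁ (rightOf (-1)))
    (Q := Reaches u₀ u₁ setKLeft) h00
    ⟨2 * (energy (u₀, u₁) - 1 / 4) / (-1 * (x - x ^ 3 / 3) - -1 * (u₀ - u₀ ^ 3 / 3)),
      fun γ hγ hK => by
        obtain ⟨T, u, v, h⟩ := exists_isMaximalSolution γ u₀ u₁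
        exact h.isSolutionOn.damping_le_of_sweeps hγ (by simp) (by linarith) (by linarith) hpos
          (hsweeps hγ h hK)⟩
    (fun γ γ' hγ hγγ' hK => by
      obtain ⟨T, u, v, h⟩ := exists_isMaximalSolution γ u₀ u₁
      obtain ⟨T', u', v', h'⟩ := exists_isMaximalSolution γ' u₀ u₁
      obtain ⟨t, ht, hut⟩ := h.exists_lt_of_sweeps h'.isSolutionOn hγ hγγ' hu₁ (ℓ := -1)
        (κ := u₀) (by norm_num) le_rfl hl
        (fun y _ hy => by
          nlinarith [mul_pos (by linarith : 0 < -y) (by nlinarith : 0 < y ^ 2 - 1)])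
        (hsweeps (hγ.trans hγγ'.le) h' hK)
      exact ⟨T, u, v, h, t, ht, hut⟩)
    (fun γ hγ hR => by
      obtain ⟨T, u, v, h, hR⟩ := hR
      rw [h.reaches_iff]
      exact h.isSolutionOn.not_setKLeft_of_rightOf hγ hu₁ hl hR)
    (fun γ hR => exists_gt_of_isOpen (isOpen_reaches (isOpen_rightOf (-1)) u₀ u₁) hR)
    (fun γ hγ hK => exists_lt_of_isOpen
      (isOpen_reaches (isOpen_energy_lt_inter (1 / 4)) u₀ u₁) hK hγ)
  -- At γ₁ = 0 the energy is conserved, and convergence to the saddle would force E = 1/4.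
  refine ⟨γ₁, lt_of_le_of_ne h0 fun h1 => ?_, hlow, hP, hQ, hup⟩
  subst h1
  obtain ⟨T, u, v, h⟩ := exists_isMaximalSolution 0 u₀ u₁
  rw [h.reaches_iff] at hP hQ
  obtain ⟨hconv, -⟩ := h.converges_neg_one_of_not le_rfl hu₁ hl hP hQ
  have hE := hconv.tendsto_energy (by norm_num)
  obtain ⟨rfl, -⟩ := hconv
  obtain ⟨t, ht1, ht2⟩ := ((hE.eventually_lt_const hN).and (eventually_ge_atTop 0)).exists
  rw [h.isSolutionOn.energy_eq_init rfl (mem_timeInterval_top.2 ht2)] at ht1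
  exact lt_irrefl _ ht1

end Main

section Main

variable {u₀ u₁ : ℝ}

/-- Slightly below the threshold `γ₁` the trajectory crosses `-1` so slowly that it is trapped
in `𝒦⁺`. -/
lemma exists_reaches_setKPlus_lt {γ₁ : ℝ} (hu₁ : 0 < u₁) (hl : u₀ < -1) (hγ₁ : 0 < γ₁)
    (hlow : ∀ γ, 0 ≤ γ → γ < γ₁ → Reaches u₀ u₁ (rightOf (-1)) γ)
    (hP : ¬ Reaches u₀ u₁ (rightOf (-1)) γ₁) (hQ : ¬ Reaches u₀ u₁ setKLeft γ₁) :
    ∃ γ, 0 < γ ∧ γ < γ₁ ∧ Reaches u₀ u₁ setKPlus γ := by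
  -- The margin γ₁/12 lies below the loss between −1 and 0, which exceeds γ₁/6 for γ > γ₁/2.
  have hS : Reaches u₀ u₁ {p | energy p < 1 / 4 + γ₁ / 12 ∧ p.1 < -1} γ₁ := by
    obtain ⟨T, u, v, h⟩ := exists_isMaximalSolution γ₁ u₀ u₁
    rw [h.reaches_iff] at hP hQ
    obtain ⟨hconv, -, hlt⟩ := h.converges_neg_one_of_not hγ₁.le hu₁ hl hP hQ
    have hE := hconv.tendsto_energy (by norm_num)
    obtain ⟨rfl, -⟩ := hconv
    have hlt' : (1 / 4 : ℝ) < 1 / 4 + γ₁ / 12 := by linarith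
    obtain ⟨t, ht1, ht2⟩ :=
      ((hE.eventually_lt_const hlt').and (eventually_ge_atTop 0)).exists
    have ht := mem_timeInterval_top.2 ht2
    exact ⟨⊤, u, v, h, t, ht, ht1, (hlt t ht).2⟩
  obtain ⟨γ, h1, h2, T, u, v, h, t, ht, hEt, hut⟩ :=
    exists_lt_of_isOpen (isOpen_reaches (isOpen_energy_lt_inter _) u₀ u₁) hS (half_lt_self hγ₁)
  have hut : u t < -1 := hut
  have hEt : energy (u t, v t) < 1 / 4 + γ₁ / 12 := hEt
  have hγ : 0 < γ := by linarith
  refine ⟨γ, hγ, h2, ?_⟩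
  by_contra hK
  have hsol := h.isSolutionOn
  have hR := hlow γ hγ.le h2
  rw [h.reaches_iff] at hK hR
  obtain ⟨r, hr, hur⟩ := hR
  obtain ⟨t₁, ht₁, -, -, hut₁, -, hv₁⟩ :=
    hsol.exists_crossing hγ.le hu₁ (by norm_num) hl hr hur
  obtain ⟨s, hs, hus, hEs, hvs⟩ := h.sweeps_one hγ.le hu₁ (by linarith) ht₁ hut₁.ge hv₁ hK 0
    (by rw [hsol.init]; linarith) one_pos
  obtain ⟨q, hq, huq⟩ := intermediate_value_Icc hs.1 (hsol.continuousOn_fst le_rfl hs)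
    (show (-1 : ℝ) ∈ Icc (u 0) (u s) from ⟨by rw [hsol.init]; exact hl.le, by rw [hus]; norm_num⟩)
  have htq : t ≤ q := by
    by_contra! hqt
    have := hsol.neg_one_le hγ.le hu₁ hq.1 huq.ge (hvs q hq) ht hqt.le
    linarith
  -- From −1 to 0 the function u − u³/3 rises by 2/3, so at least γ/3 of energy is lost and E < 1/4
  -- at 0.
  have h3 := hsol.energy_add_le hγ.le 1 (by simp) hq.1 hq.2 hs hEs fun r hr =>
    hvs r ⟨hq.1.trans hr.1, hr.2⟩
  have h4 := hsol.energy_le hγ.le ht.1 htq (mem_timeInterval_of_le hs hq.1 hq.2)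
  rw [hus, huq] at h3
  rw [hus] at hEs
  rw [huq] at h4
  linarith

/-- The threshold for the saddle `(1, 0)` for data in `𝒩₃`. -/
theorem exists_threshold_right {γ₁ : ℝ} (hN : 1 / 4 < energy (u₀, u₁)) (hu₁ : 0 < u₁)
    (hl : u₀ < -1) (hγ₁ : 0 < γ₁) (hlow₁ : ∀ γ, 0 ≤ γ → γ < γ₁ → Reaches u₀ u₁ (rightOf (-1)) γ)
    (hP₁ : ¬ Reaches u₀ u₁ (rightOf (-1)) γ₁) (hQ₁ : ¬ Reaches u₀ u₁ setKLeft γ₁)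
    (hup₁ : ∀ γ, γ₁ < γ → Reaches u₀ u₁ setKLeft γ) :
    ∃ γ₀, 0 ≤ γ₀ ∧ γ₀ < γ₁ ∧ (∀ γ, 0 ≤ γ → γ < γ₀ → Reaches u₀ u₁ (rightOf 1) γ) ∧
      ¬ Reaches u₀ u₁ (rightOf 1) γ₀ ∧ ¬ Reaches u₀ u₁ setKPlus γ₀ ∧
      ∀ γ, γ₀ < γ → γ < γ₁ → Reaches u₀ u₁ setKPlus γ := by
  have hl1 : u₀ < 1 := by linarith
  -- Adjoining γ₁ ≤ γ to Q bounds the threshold. Leftward persistence of Q at and beyond γ₁ is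
  -- supplied by `exists_reaches_setKPlus_lt`, and failure of Q at γ₀ yields γ₀ < γ₁.
  obtain ⟨γ₀, h0, hlow, hP, hQ, hup⟩ := exists_threshold (P := Reaches u₀ u₁ (rightOf 1))
    (Q := fun γ => Reaches u₀ u₁ setKPlus γ ∨ γ₁ ≤ γ)
    (not_or.2 ⟨not_reaches_of_zero (fun p hp => hp.1) hN.le, not_le.2 hγ₁⟩)
    ⟨γ₁, fun γ _ hQ => (not_le.1 (not_or.1 hQ).2).le⟩
    (fun γ γ' hγ hγγ' hQ => by
      obtain ⟨hK, hlt⟩ := not_or.1 hQ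
      have hγ' := hγ.trans hγγ'.le
      obtain ⟨T, u, v, h⟩ := exists_isMaximalSolution γ u₀ u₁
      obtain ⟨T', u', v', h'⟩ := exists_isMaximalSolution γ' u₀ u₁
      obtain ⟨r, hr, hur⟩ := h'.reaches_iff.1 (hlow₁ γ' hγ' (not_le.1 hlt))
      obtain ⟨t₁, ht₁, -, -, hut₁, -, hv₁⟩ :=
        h'.isSolutionOn.exists_crossing hγ' hu₁ (by norm_num) hl hr hur
      rw [h'.reaches_iff] at hK
      obtain ⟨t, ht, hut⟩ := h.exists_lt_of_sweeps h'.isSolutionOn hγ hγγ' hu₁ (ℓ := 1)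
        (κ := 0) (by norm_num) (by linarith) one_pos
        (fun y hy hy1 => by nlinarith [mul_nonneg hy (by nlinarith : 0 ≤ 1 - y ^ 2)])
        (h'.sweeps_one hγ' hu₁ hl1 ht₁ hut₁.ge hv₁ hK)
      exact ⟨T, u, v, h, t, ht, hut⟩)
    (fun γ hγ hR hQ => by
      obtain ⟨T, u, v, h, t, ht, hut⟩ := hR
      have hR' : Enters T u v (rightOf (-1)) := ⟨t, ht, lt_trans (by norm_num : (-1 : ℝ) < 1) hut⟩
      rcases hQ with hK | hle
      · rw [h.reaches_iff] at hK
        exact h.isSolutionOn.not_setKPlus_of_rightOf hγ hu₁ hl1 ⟨t, ht, hut⟩ hK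
      · rcases hle.eq_or_lt with rfl | hlt
        · exact hP₁ (h.reaches_iff.2 hR')
        · exact h.isSolutionOn.not_setKLeft_of_rightOf hγ hu₁ hl hR'
            (h.reaches_iff.1 (hup₁ γ hlt)))
    (fun γ hR => exists_gt_of_isOpen (isOpen_reaches (isOpen_rightOf 1) u₀ u₁) hR)
    (fun γ hγ hQ => by
      rcases hQ with hK | hle
      · obtain ⟨γ', h1, h2, h3⟩ :=
          exists_lt_of_isOpen (isOpen_reaches isOpen_setKPlus u₀ u₁) hK hγ
        exact ⟨γ', h1, h2, Or.inl h3⟩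
      · obtain ⟨γ', h1, h2, h3⟩ := exists_reaches_setKPlus_lt hu₁ hl hγ₁ hlow₁ hP₁ hQ₁
        exact ⟨γ', h1, h2.trans_le hle, Or.inl h3⟩)
  obtain ⟨hK, hlt⟩ := not_or.1 hQ
  exact ⟨γ₀, h0, not_le.1 hlt, hlow, hP, hK, fun γ h1 h2 =>
    (hup γ h1).resolve_right (not_le.2 h2)⟩

variable {γ : ℝ} {T : EReal} {u v : ℝ → ℝ}

lemma IsMaximalSolution.converges_zero_of_reaches (h : IsMaximalSolution γ u₀ u₁ T u v)
    (hγ : 0 < γ) (hK : Reaches u₀ u₁ setKPlus γ) : ConvergesExponentially T u v (0, 0) := by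
  obtain ⟨t, ht, hE, hut⟩ := h.reaches_iff.1 hK
  exact h.convergesExponentially_zero hγ ht hut hE

/-- Without damping, trajectories of energy `1/4` on the stable manifold of `(-1, 0)` converge. -/
lemma IsMaximalSolution.converges_neg_one_of_energy_eq (h : IsMaximalSolution 0 u₀ u₁ T u v)
    (hu₁ : 0 < u₁) (hl : u₀ < -1) (hE : energy (u₀, u₁) = 1 / 4) :
    ConvergesExponentially T u v (-1, 0) := by
  have hsol := h.isSolutionOn
  refine (h.converges_neg_one_of_not le_rfl hu₁ hl ?_ ?_).1
  · rintro ⟨t, ht, hut⟩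
    obtain ⟨t₁, ht₁, -, -, -, hE₁, -⟩ :=
      hsol.exists_crossing le_rfl hu₁ (by norm_num) hl ht hut
    rw [hsol.energy_eq_init rfl ht₁] at hE₁
    linarith
  · rw [← h.reaches_iff]
    exact not_reaches_of_zero (fun p hp => hp.1) hE.ge

/-- Positive damping lowers the energy strictly below 1/4 at once, before u can leave u < −1. -/
lemma IsSolutionOn.enters_setKLeft_of_energy_eq (h : IsSolutionOn γ u₀ u₁ T u v) (hγ : 0 < γ)
    (hu₁ : 0 < u₁) (hl : u₀ < -1) (hE : energy (u₀, u₁) = 1 / 4) : Enters T u v setKLeft := by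
  have h0 := h.zero_mem
  obtain ⟨b, hb0, hb⟩ := exists_gt_mem_timeInterval h0
  have hv : ∀ᶠ t in 𝓝[≥] (0 : ℝ), 0 < v t :=
    (h.hasDeriv_deriv 0 h0).continuousWithinAt.tendsto.eventually_const_lt
      (by rwa [h.init_deriv])
  have hu : ∀ᶠ t in 𝓝[≥] (0 : ℝ), u t < -1 :=
    (h.hasDeriv 0 h0).continuousWithinAt.tendsto.eventually_lt_const (by rwa [h.init])
  obtain ⟨c, hc, hcs⟩ := mem_nhdsGE_iff_exists_Icc_subset.1 (hv.and hu)
  have hc : 0 < c := hc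
  have hm : 0 < min b c := lt_min hb0 hc
  have hmT := mem_timeInterval_of_le hb hm.le (min_le_left b c)
  refine ⟨min b c, hmT, ?_, (hcs ⟨hm.le, min_le_right b c⟩).2⟩
  have h1 := lt_of_deriv_pos le_rfl hm
    (fun t ht => (h.hasDeriv_energy_of_mem le_rfl hmT t ht).fun_neg) fun t ht => by
      have h2 : 0 < v t := (hcs ⟨ht.1.le, ht.2.le.trans (min_le_right b c)⟩).1
      have : 0 < γ * v t ^ 2 := by positivity
      linarith
  rw [h.init, h.init_deriv, hE] at h1
  linarith

end Main

end Duffing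

/-! ### Assembly of the four cases -/

theorem mainTheorem2 (u₀ u₁ : ℝ) (hN : (u₀, u₁) ∈ Duffing.setN) (hu₁ : 0 < u₁) :
    -- for every damping there is a maximal solution
    (∀ γ : ℝ, 0 ≤ γ → ∃ (T : EReal) (u v : ℝ → ℝ), Duffing.IsMaximalSolution γ u₀ u₁ T u v) ∧
    -- (i)
    ((u₀, u₁) ∈ Duffing.setN1 →
      ∀ (γ : ℝ) (T : EReal) (u v : ℝ → ℝ), 0 ≤ γ → Duffing.IsMaximalSolution γ u₀ u₁ T u v →
        Duffing.BlowsUp T ∧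
        (0 < γ → Duffing.Enters T u v (Duffing.setKMinus ∩ {p | 1 < p.1}))) ∧
    -- (ii)
    ((u₀, u₁) ∈ Duffing.setN2 →
      ∃ γ₀ : ℝ, 0 ≤ γ₀ ∧
        (∀ (γ : ℝ) (T : EReal) (u v : ℝ → ℝ), 0 ≤ γ → Duffing.IsMaximalSolution γ u₀ u₁ T u v →
          (γ < γ₀ → Duffing.Enters T u v Duffing.setN1 ∧ Duffing.BlowsUp T) ∧
          (γ = γ₀ → Duffing.ConvergesExponentially T u v (1, 0)) ∧
          (γ₀ < γ → Duffing.ConvergesExponentially T u v (0, 0))) ∧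
        (Duffing.energy (u₀, u₁) = 1 / 4 → γ₀ = 0)) ∧
    -- (iii)
    ((u₀, u₁) ∈ Duffing.setN3 → 1 / 4 < Duffing.energy (u₀, u₁) →
      ∃ γ₀ γ₁ : ℝ, 0 ≤ γ₀ ∧ γ₀ < γ₁ ∧
        ∀ (γ : ℝ) (T : EReal) (u v : ℝ → ℝ), 0 ≤ γ → Duffing.IsMaximalSolution γ u₀ u₁ T u v →
          (γ < γ₀ → Duffing.Enters T u v Duffing.setN1 ∧ Duffing.BlowsUp T) ∧
          (γ = γ₀ → Duffing.ConvergesExponentially T u v (1, 0)) ∧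
          (γ₀ < γ → γ < γ₁ → Duffing.ConvergesExponentially T u v (0, 0)) ∧
          (γ = γ₁ → Duffing.ConvergesExponentially T u v (-1, 0)) ∧
          (γ₁ < γ → Duffing.Enters T u v (Duffing.setKMinus ∩ {p | p.1 < -1}) ∧
            Duffing.BlowsUp T)) ∧
    -- (iv)
    ((u₀, u₁) ∈ Duffing.setN3 → Duffing.energy (u₀, u₁) = 1 / 4 →
      ∀ (γ : ℝ) (T : EReal) (u v : ℝ → ℝ), 0 ≤ γ → Duffing.IsMaximalSolution γ u₀ u₁ T u v →
        (γ = 0 → Duffing.ConvergesExponentially T u v (-1, 0)) ∧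
        (0 < γ → Duffing.Enters T u v (Duffing.setKMinus ∩ {p | p.1 < -1}) ∧
          Duffing.BlowsUp T)) := by
  refine ⟨fun γ _ => Duffing.exists_isMaximalSolution γ u₀ u₁, ?_, ?_, ?_, ?_⟩
  · rintro ⟨-, -, hu₀⟩ γ T u v hγ h
    refine ⟨?_, fun hγ' => h.enters_setKMinus hγ' hu₀ hu₁⟩
    have hsol := h.isSolutionOn
    exact h.blowsUp_of_one_le hγ hsol.zero_mem (by rwa [hsol.init]) (by rwa [hsol.init_deriv])
  · rintro ⟨-, -, hl, hr⟩
    obtain ⟨γ₀, h0, hlow, hP, hQ, hup, hE⟩ := Duffing.exists_threshold_setN2 hN hu₁ hl hr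
    refine ⟨γ₀, h0, fun γ T u v hγ h => ⟨fun hlt => ?_, fun heq => ?_, fun hlt => ?_⟩, hE⟩
    · exact h.enters_setN1 hγ hu₁ hr (h.reaches_iff.1 (hlow γ hγ hlt))
    · subst heq
      have hsol := h.isSolutionOn
      exact (h.converges_one_of_not hγ hu₁ hr hsol.zero_mem (by rwa [hsol.init])
        (fun r hr => by rwa [le_antisymm hr.2 hr.1, hsol.init_deriv])
        (fun hR => hP (h.reaches_iff.2 hR)) fun hK => hQ (h.reaches_iff.2 hK)).1
    · exact h.converges_zero_of_reaches (h0.trans_lt hlt) (hup γ hlt)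
  · rintro ⟨-, -, hl⟩ hE
    have hl : u₀ < -1 := hl
    obtain ⟨γ₁, h1, hlow₁, hP₁, hQ₁, hup₁⟩ := Duffing.exists_threshold_left hE hu₁ hl
    obtain ⟨γ₀, h0, h01, hlow, hP, hQ, hup⟩ :=
      Duffing.exists_threshold_right hE hu₁ hl h1 hlow₁ hP₁ hQ₁ hup₁
    refine ⟨γ₀, γ₁, h0, h01, fun γ T u v hγ h => ⟨fun hlt => ?_, fun heq => ?_, fun hlt hlt' => ?_,
      fun heq => ?_, fun hlt => ?_⟩⟩
    · exact h.enters_setN1 hγ hu₁ (by linarith) (h.reaches_iff.1 (hlow γ hγ hlt))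
    · subst heq
      obtain ⟨r, hr, hur⟩ := h.reaches_iff.1 (hlow₁ γ hγ h01)
      obtain ⟨t₁, ht₁, -, -, hut₁, -, hv₁⟩ :=
        h.isSolutionOn.exists_crossing hγ hu₁ (by norm_num) hl hr hur
      exact (h.converges_one_of_not hγ hu₁ (by linarith) ht₁ hut₁.ge hv₁
        (fun hR => hP (h.reaches_iff.2 hR)) fun hK => hQ (h.reaches_iff.2 hK)).1
    · exact h.converges_zero_of_reaches (h0.trans_lt hlt) (hup γ hlt hlt')
    · subst heq
      exact (h.converges_neg_one_of_not hγ hu₁ hl (fun hR => hP₁ (h.reaches_iff.2 hR))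
        fun hK => hQ₁ (h.reaches_iff.2 hK)).1
    · exact h.enters_setKMinus_left hγ (h.reaches_iff.1 (hup₁ γ hlt))
  · rintro ⟨-, -, hl⟩ hE γ T u v hγ h
    refine ⟨fun heq => ?_, fun hlt => ?_⟩
    · subst heq
      exact h.converges_neg_one_of_energy_eq hu₁ hl hE
    · exact h.enters_setKMinus_left hγ
        (h.isSolutionOn.enters_setKLeft_of_energy_eq hlt hu₁ hl hE)
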